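/- Let $T>0$, let $\Theta\subset\mathbb{R}^p$ be compact, and for $\theta\in\Theta$, $t\in[0,T]$ let $A_\theta(t)\in\mathbb{R}^{d\times d}$. Let $C\in\mathbb{R}^{d'\times d}$, $B\in\mathbb{R}^{d\times d_u}$, and let $U\in\mathbb{R}^{d_u\times d_u}$ be symmetric positive definite. For $x_0\in\mathbb{R}^d$ let $X_{\theta,x_0}$ be the solution on $[0,T]$ of $\dot X(t)=A_\theta(t)X(t)$, $X(0)=x_0$. Fix a true parameter $\theta^*\in\Theta$ and a true initial condition $x_0^*\in\mathbb{R}^d$. For $n\ge 1$ put $\Delta=T/n$, $t_i=i\Delta$, and suppose that one observes $$Y_i=C X_{\theta^*,x_0^*}(t_i)+\epsilon_i,\qquad i=0,\dots,n,$$ where $\epsilon_0,\epsilon_1,\dots$ are i.i.d. with law $N(0,\sigma^2 I_{d'})$. For $\theta\in\Theta$ define the profiled cost $$S_n^{CI}(Y;\theta)=\inf_{x_0\in\mathbb{R}^d}\ \inf_{u_0,\dots,u_{n-1}\in\mathbb{R}^{d_u}}\Big\{\sum_{i=0}^{n}\Delta\,\|C X^d_i-Y_i\|_2^2+\sum_{i=0}^{n-1}\Delta\,u_i^{T}Uu_i\Big\},$$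 where $X^d_0=x_0$ and $X^d_{i+1}=(I_d+\Delta A_\theta(t_i))X^d_i+\Delta B u_i$ for $0\le i<n$. Assume: - (L1) for every $\theta\in\Theta$, $t\mapsto A_\theta(t)$ is differentiable on $[0,T]$; - (L2) $\theta\mapsto A_\theta$ is continuous on $\Theta$, with respect to uniform convergence on $[0,T]$; - (L3) for every $\theta\in\Theta$ the matrix $R_\theta(0)$ is nonsingular, where $R_\theta$ is the solution on $[0,T]$ of the Riccati equation $\dot R_\theta=-C^TC-A_\theta^TR_\theta-R_\theta A_\theta+R_\theta BU^{-1}B^TR_\theta$ with $R_\theta(T)=0$; - (L4) $\theta^*$ belongs to the interior of $\Theta$; - (L5) if $\theta\in\Theta$ and $x_0\in\mathbb{R}^d$ satisfy $CX_{\theta,x_0}(t)=CX_{\theta^*,x_0^*}(t)$ for all $t\in[0,T]$, then $(\theta,x_0)=(\theta^*,x_0^*)$. Let $\widehat\theta=\widehat\theta_n$ be random variables such that, for all sufficiently large $n$, almost surely $\widehat\theta_n\in\Theta$ and $\widehat\theta_n$ minimises $\theta\mapsto S_n^{CI}(Y;\theta)$ over $\Theta$. Then $\widehat\theta_n\to\theta^*$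 in probability as $n\to\infty$. -/

import Mathlib

open Filter Topology MeasureTheory ProbabilityTheory Set
open scoped Matrix

noncomputable section

namespace LinearODEModel

/-- The observation time `t_i = i T / n`. -/
def meshTime (T : ℝ) (n i : ℕ) : ℝ := i * (T / n)

/-- `X` solves `X'(t) = A(t) X(t)` on `[0, T]` with `X(0) = x₀`. -/
def IsSolution {d : ℕ} (T : ℝ) (A : ℝ → Matrix (Fin d) (Fin d) ℝ) (x₀ : Fin d → ℝ)
    (X : ℝ → Fin d → ℝ) : Prop :=
  X 0 = x₀ ∧ ∀ t ∈ Icc (0 : ℝ) T, HasDerivWithinAt X (A t *ᵥ X t) (Icc 0 T) t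

/-- `R` solves the matrix Riccati equation
`R' = -CᵀC - AᵀR - RA + R B U⁻¹ Bᵀ R` on `[0, T]` with `R(T) = 0` (derivatives are taken entry by
entry). -/
def IsRiccatiSolution {d d' du : ℕ} (T : ℝ) (A : ℝ → Matrix (Fin d) (Fin d) ℝ)
    (B : Matrix (Fin d) (Fin du) ℝ) (C : Matrix (Fin d') (Fin d) ℝ)
    (U : Matrix (Fin du) (Fin du) ℝ) (R : ℝ → Matrix (Fin d) (Fin d) ℝ) : Prop :=
  R T = 0 ∧ ∀ t ∈ Icc (0 : ℝ) T, ∀ i j,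
    HasDerivWithinAt (fun s => R s i j)
      ((-(Cᵀ * C) - (A t)ᵀ * R t - R t * A t + R t * B * U⁻¹ * Bᵀ * R t) i j) (Icc 0 T) t

/-- The finite difference trajectory
`X(t_{i+1}) = (I + Δ A(t_i)) X(t_i) + Δ B u_i`, `X(t_0) = x₀`, with `Δ = T / n`. -/
def discreteTrajectory {d du : ℕ} (T : ℝ) (n : ℕ) (A : ℝ → Matrix (Fin d) (Fin d) ℝ)
    (B : Matrix (Fin d) (Fin du) ℝ) (x₀ : Fin d → ℝ) (u : ℕ → Fin du → ℝ) : ℕ → Fin d → ℝ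
  | 0 => x₀
  | i + 1 =>
    (1 + (T / n) • A (meshTime T n i)) *ᵥ discreteTrajectory T n A B x₀ u i
      + (T / n) • (B *ᵥ u i)

/-- The discretized cost
`∑_{i=0}^{n} Δ ‖C X(t_i) - y_i‖² + ∑_{i=0}^{n-1} Δ u_iᵀ U u_i` (Euclidean norm). Only
`u_0, …, u_{n-1}` and `y_0, …, y_n` enter. -/
def discreteCost {d d' du : ℕ} (T : ℝ) (n : ℕ) (A : ℝ → Matrix (Fin d) (Fin d) ℝ)
    (B : Matrix (Fin d) (Fin du) ℝ) (C : Matrix (Fin d') (Fin d) ℝ)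
    (U : Matrix (Fin du) (Fin du) ℝ) (y : ℕ → EuclideanSpace ℝ (Fin d'))
    (x₀ : Fin d → ℝ) (u : ℕ → Fin du → ℝ) : ℝ :=
  (∑ i ∈ Finset.range (n + 1),
      (T / n) * ‖WithLp.toLp 2 (C *ᵥ discreteTrajectory T n A B x₀ u i) - y i‖ ^ 2)
    + ∑ i ∈ Finset.range n, (T / n) * (u i ⬝ᵥ (U *ᵥ u i))

/-- The cost profiled on the control and then on the initial condition,
`S_n^{CI} = inf_{x₀} inf_u` of the discretized cost. -/
def profiledCost {d d' du : ℕ} (T : ℝ) (n : ℕ) (A : ℝ → Matrix (Fin d) (Fin d) ℝ)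
    (B : Matrix (Fin d) (Fin du) ℝ) (C : Matrix (Fin d') (Fin d) ℝ)
    (U : Matrix (Fin du) (Fin du) ℝ) (y : ℕ → EuclideanSpace ℝ (Fin d')) : ℝ :=
  ⨅ x₀ : Fin d → ℝ, ⨅ u : ℕ → Fin du → ℝ, discreteCost T n A B C U y x₀ u

/-- The observations `Y_i = C X*(t_i) + ε_i`. -/
def observation {d d' : ℕ} {Ω : Type*} (T : ℝ) (n : ℕ) (C : Matrix (Fin d') (Fin d) ℝ)
    (Xstar : ℝ → Fin d → ℝ) (ε : ℕ → Ω → EuclideanSpace ℝ (Fin d')) (ω : Ω) (i : ℕ) :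
    EuclideanSpace ℝ (Fin d') :=
  WithLp.toLp 2 (C *ᵥ Xstar (meshTime T n i)) + ε i ω

end LinearODEModel

end

namespace LinearODEModel

/-! The convergence is proved almost surely. By the strong law the averages of the errors vanish for
almost every `ω`; for such an `ω` the rest of the argument is deterministic
(`tendsto_of_minimizes_profiledCost`).

Expand the cost around the true output. A term depending only on the noise cancels when parameters
are compared; there remain the squared residuals, the control penalty and a cross term between
residual and noise. Summation by parts (`abs_mul_sum_inner_le`) bounds the cross term by normalised
partial sums of the noise, which tend to zero uniformly, times the endpoint and variation of the
residual. These grow at most linearly in `1 + ‖x‖ + v`, where `x` is the initial condition and `v`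
the discrete L¹ norm of the control. Comparison with the true parameter, true initial condition and
zero control shows that a near-minimiser has energy at most `o(1) * (1 + ‖x‖ + v)`.

No bound on `x` is available, so everything is multiplied by `l = 1 / (1 + ‖x‖)`. The rescaled
energy and control then vanish. By compactness, along a subsequence `θ → θ₀`, `l → c` and `l x → x₀`
with `‖x₀‖ = 1 - c`, and the rescaled trajectories converge to the unforced solution for `θ₀` from
`x₀`, whose output is `c` times the true output (`exists_isSolution_of_near_minimizers`). If `c =
0`, a nonzero initial condition is invisible through `C`, which nonsingularity of the Riccati
solution at time `0` forbids (`eq_zero_of_forall_mulVec_eq_zero`). Otherwise division by `c` and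
identifiability give `θ₀ = θ*`. -/

/-! ### Linear differential equations on `[0, T]` -/

lemma norm_mulVec_le_of_abs_le {m n : ℕ} {A : Matrix (Fin m) (Fin n) ℝ} {c : ℝ} (hc : 0 ≤ c)
    (h : ∀ i j, |A i j| ≤ c) (x : Fin n → ℝ) : ‖A *ᵥ x‖ ≤ n * c * ‖x‖ := by
  refine (pi_norm_le_iff_of_nonneg (by positivity)).2 fun i => ?_
  calc ‖(A *ᵥ x) i‖ ≤ ∑ j, ‖A i j * x j‖ :=
        norm_sum_le Finset.univ fun j => A i j * x j
    _ ≤ ∑ _j : Fin n, c * ‖x‖ := by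
        refine Finset.sum_le_sum fun j _ => ?_
        rw [norm_mul]
        exact mul_le_mul (h i j) (norm_le_pi_norm x j) (norm_nonneg _) hc
    _ = n * c * ‖x‖ := by simp [mul_assoc]

lemma exists_norm_mulVec_le {m n : ℕ} {T : ℝ} {A : ℝ → Matrix (Fin m) (Fin n) ℝ}
    (hA : ∀ i j, ContinuousOn (fun t => A t i j) (Icc 0 T)) :
    ∃ M : ℝ, 0 ≤ M ∧ ∀ t ∈ Icc (0 : ℝ) T, ∀ x, ‖A t *ᵥ x‖ ≤ M * ‖x‖ := by
  have key : ∀ i j, ∃ c : ℝ, ∀ t ∈ Icc (0 : ℝ) T, ‖A t i j‖ ≤ c := fun i j =>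
    isCompact_Icc.exists_bound_of_continuousOn (hA i j)
  choose c hc using key
  refine ⟨n * ∑ i, ∑ j, |c i j|, by positivity, fun t ht x => ?_⟩
  refine norm_mulVec_le_of_abs_le (by positivity) (fun i j => ?_) x
  calc |A t i j| ≤ |c i j| := (hc i j t ht).trans (le_abs_self _)
    _ ≤ ∑ j, |c i j| :=
      Finset.single_le_sum (f := fun j => |c i j|) (fun _ _ => abs_nonneg _) (Finset.mem_univ j)
    _ ≤ _ := Finset.single_le_sum (f := fun i => ∑ j, |c i j|) (fun _ _ => by positivity)
      (Finset.mem_univ i)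

lemma continuousOn_mulVec {m n : ℕ} {s : Set ℝ} {A : ℝ → Matrix (Fin m) (Fin n) ℝ}
    {X : ℝ → Fin n → ℝ} (hA : ∀ i j, ContinuousOn (fun t => A t i j) s)
    (hX : ContinuousOn X s) : ContinuousOn (fun t => A t *ᵥ X t) s := by
  refine continuousOn_pi.2 fun i => ?_
  change ContinuousOn (fun t => ∑ j, A t i j * X t j) s
  exact continuousOn_finsetSum _ fun j _ => (hA i j).mul (continuousOn_pi.1 hX j)

lemma hasDerivWithinAt_Ici_of_Icc {E : Type*} [NormedAddCommGroup E] [NormedSpace ℝ E]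
    {f : ℝ → E} {f' : E} {a b t : ℝ} (ht : t ∈ Ico a b)
    (h : HasDerivWithinAt f f' (Icc a b) t) : HasDerivWithinAt f f' (Ici t) t :=
  h.mono_of_mem_nhdsWithin (Icc_mem_nhdsGE_of_mem ht)

/-- A function on `[0, T]` with `‖q'‖ ≤ K ‖q‖` that vanishes at `T` vanishes at `0`. -/
lemma eq_zero_of_norm_deriv_le_of_terminal_eq_zero {E : Type*} [NormedAddCommGroup E]
    [NormedSpace ℝ E] {T K : ℝ} (hT : 0 ≤ T) {q q' : ℝ → E}
    (hq : ∀ t ∈ Icc (0 : ℝ) T, HasDerivWithinAt q (q' t) (Icc 0 T) t)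
    (hK : ∀ t ∈ Icc (0 : ℝ) T, ‖q' t‖ ≤ K * ‖q t‖) (hqT : q T = 0) : q 0 = 0 := by
  have hmaps : MapsTo (fun s : ℝ => T - s) (Icc 0 T) (Icc 0 T) := fun s hs =>
    ⟨by linarith [hs.2], by linarith [hs.1]⟩
  -- Time reversal turns the terminal condition into an initial one, to which Gronwall applies.
  have hd : ∀ s ∈ Icc (0 : ℝ) T,
      HasDerivWithinAt (fun s => q (T - s)) (-q' (T - s)) (Icc 0 T) s := by
    intro s hs
    have := (hq (T - s) (hmaps hs)).scomp s
      (((hasDerivAt_id s).const_sub T).hasDerivWithinAt (s := Icc 0 T)) hmaps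
    simpa [Function.comp_def] using this
  have := eq_zero_of_abs_deriv_le_mul_abs_self_of_eq_zero_right (f := fun s => q (T - s))
    (f' := fun s => -q' (T - s)) (K := K) (a := 0) (b := T)
    (fun s hs => (hd s hs).continuousWithinAt)
    (fun s hs => hasDerivWithinAt_Ici_of_Icc hs (hd s (Ico_subset_Icc_self hs)))
    (by simpa using hqT)
    (fun s hs => by simpa using hK _ (hmaps (Ico_subset_Icc_self hs))) T ⟨hT, le_rfl⟩
  simpa using this

/-- Coordinatewise truncation at level `R`. -/
noncomputable def clamp {d : ℕ} (R : ℝ) (x : Fin d → ℝ) : Fin d → ℝ :=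
  fun i => max (-R) (min R (x i))

lemma norm_clamp_sub_clamp_le {d : ℕ} (R : ℝ) (x y : Fin d → ℝ) :
    ‖clamp R x - clamp R y‖ ≤ ‖x - y‖ := by
  refine (pi_norm_le_iff_of_nonneg (norm_nonneg _)).2 fun i => ?_
  refine le_trans ?_ (norm_le_pi_norm (x - y) i)
  simp only [clamp, Pi.sub_apply, Real.norm_eq_abs]
  calc _ ≤ |min R (x i) - min R (y i)| := by
        simpa using abs_max_sub_max_le_max (-R) (min R (x i)) (-R) (min R (y i))
    _ ≤ _ := by simpa using abs_min_sub_min_le_max R (x i) R (y i)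

lemma norm_clamp_le {d : ℕ} {R : ℝ} (hR : 0 ≤ R) (x : Fin d → ℝ) : ‖clamp R x‖ ≤ R := by
  refine (pi_norm_le_iff_of_nonneg hR).2 fun i => ?_
  rw [Real.norm_eq_abs, abs_le]
  exact ⟨le_max_left _ _, max_le (by linarith) (min_le_left _ _)⟩

lemma clamp_eq_self {d : ℕ} {R : ℝ} {x : Fin d → ℝ} (hx : ‖x‖ ≤ R) : clamp R x = x := by
  funext i
  have := (norm_le_pi_norm x i).trans hx
  rw [Real.norm_eq_abs, abs_le] at this
  simp [clamp, this.1, this.2]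

/-- A linear differential equation with continuous coefficients has a solution on `[0, T]`. -/
theorem exists_isSolution {d : ℕ} {T : ℝ} (hT : 0 ≤ T) {A : ℝ → Matrix (Fin d) (Fin d) ℝ}
    (hA : ∀ i j, ContinuousOn (fun t => A t i j) (Icc 0 T)) (x₀ : Fin d → ℝ) :
    ∃ X, IsSolution T A x₀ X := by
  obtain ⟨M, hM0, hM⟩ := exists_norm_mulVec_le hA
  -- The Gronwall bound for a solution on `[0, T]`. Truncation at this level makes the field
  -- globally bounded by `M * R`, so Picard–Lindelöf reaches time `T` in one step, and the solution
  -- obtained is never truncated.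
  set R : ℝ := ‖x₀‖ * Real.exp (M * T) with hR
  have hR0 : 0 ≤ R := by positivity
  have hclamp : ∀ x : Fin d → ℝ, ‖clamp R x‖ ≤ ‖x‖ := fun x => by
    have h0 : clamp R (0 : Fin d → ℝ) = 0 := clamp_eq_self (by simpa using hR0)
    simpa [h0] using norm_clamp_sub_clamp_le R x 0
  have hPL : IsPicardLindelof (fun t x => A t *ᵥ clamp R x) (tmin := 0) (tmax := T)
      ⟨0, le_rfl, hT⟩ x₀ ⟨M * R * T, by positivity⟩ 0 ⟨M * R, by positivity⟩ ⟨M, hM0⟩ := by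
    refine ⟨fun t ht => ?_, fun x _ => ?_, fun t ht x _ => ?_, ?_⟩
    · refine LipschitzOnWith.of_dist_le_mul fun x _ y _ => ?_
      rw [dist_eq_norm, dist_eq_norm, ← Matrix.mulVec_sub]
      exact (hM t ht _).trans (mul_le_mul_of_nonneg_left (norm_clamp_sub_clamp_le R x y) hM0)
    · exact continuousOn_mulVec hA continuousOn_const
    · exact (hM t ht _).trans (mul_le_mul_of_nonneg_left (norm_clamp_le hR0 x) hM0)
    · simp only [sub_zero, sub_self, NNReal.coe_zero, max_eq_left hT]
      exact le_rfl
  obtain ⟨X, hX0, hX⟩ := hPL.exists_eq_forall_mem_Icc_hasDerivWithinAt₀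
  refine ⟨X, hX0, fun t ht => ?_⟩
  have hbound : ∀ t ∈ Icc (0 : ℝ) T, ‖X t‖ ≤ R := by
    intro t ht
    have := norm_le_gronwallBound_of_norm_deriv_right_le (f := X)
      (f' := fun t => A t *ᵥ clamp R (X t)) (δ := ‖x₀‖) (K := M) (ε := 0) (a := 0) (b := T)
      (fun s hs => (hX s hs).continuousWithinAt)
      (fun s hs => hasDerivWithinAt_Ici_of_Icc hs (hX s (Ico_subset_Icc_self hs)))
      (le_of_eq (congrArg norm hX0))
      (fun s hs => by
        rw [add_zero]
        exact (hM s (Ico_subset_Icc_self hs) _).trans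
          (mul_le_mul_of_nonneg_left (hclamp _) hM0)) t ht
    rw [gronwallBound_ε0, sub_zero] at this
    refine this.trans ?_
    rw [hR]
    gcongr
    exact ht.2
  have := hX t ht
  rwa [clamp_eq_self (hbound t ht)] at this

lemma IsSolution.continuousOn {d : ℕ} {T : ℝ} {A : ℝ → Matrix (Fin d) (Fin d) ℝ}
    {x₀ : Fin d → ℝ} {X : ℝ → Fin d → ℝ} (hX : IsSolution T A x₀ X) :
    ContinuousOn X (Icc 0 T) := fun t ht => (hX.2 t ht).continuousWithinAt

lemma IsSolution.smul {d : ℕ} {T : ℝ} {A : ℝ → Matrix (Fin d) (Fin d) ℝ}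
    {x₀ : Fin d → ℝ} {X : ℝ → Fin d → ℝ} (hX : IsSolution T A x₀ X) (c : ℝ) :
    IsSolution T A (c • x₀) (fun t => c • X t) := by
  refine ⟨by simp [hX.1], fun t ht => ?_⟩
  rw [Matrix.mulVec_smul]
  exact (hX.2 t ht).const_smul c

/-! ### Observability from the Riccati equation -/

/-- If the Riccati solution is nonsingular at time `0`, the initial condition of an unforced
trajectory that is not seen through `C` vanishes. -/
theorem eq_zero_of_forall_mulVec_eq_zero {d d' du : ℕ} {T : ℝ} (hT : 0 ≤ T)
    {A : ℝ → Matrix (Fin d) (Fin d) ℝ} {B : Matrix (Fin d) (Fin du) ℝ}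
    {C : Matrix (Fin d') (Fin d) ℝ} {U : Matrix (Fin du) (Fin du) ℝ}
    (hA : ∀ i j, ContinuousOn (fun t => A t i j) (Icc 0 T))
    {R : ℝ → Matrix (Fin d) (Fin d) ℝ} (hR : IsRiccatiSolution T A B C U R) (hR0 : IsUnit (R 0))
    {x₀ : Fin d → ℝ} {X : ℝ → Fin d → ℝ} (hX : IsSolution T A x₀ X)
    (hCX : ∀ t ∈ Icc (0 : ℝ) T, C *ᵥ X t = 0) : x₀ = 0 := by
  have hRc : ∀ i j, ContinuousOn (fun t => R t i j) (Icc 0 T) := fun i j t ht =>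
    (hR.2 t ht i j).continuousWithinAt
  have hGc : ∀ i j, ContinuousOn (fun t => (-(A t)ᵀ + R t * (B * U⁻¹ * Bᵀ)) i j) (Icc 0 T) := by
    intro i j
    simp only [Matrix.add_apply, Matrix.neg_apply, Matrix.transpose_apply]
    refine (hA j i).neg.add ?_
    simp only [Matrix.mul_apply (M := R _)]
    exact continuousOn_finsetSum _ fun k _ => (hRc i k).mul continuousOn_const
  obtain ⟨K, -, hK⟩ := exists_norm_mulVec_le hGc
  -- For `q = R X`, the term `CᵀC X` vanishes and the two `R A X` terms cancel, so `q` solves a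
  -- homogeneous linear equation with `q(T) = 0`; hence `R(0) x₀ = q(0) = 0`.
  have hd : ∀ t ∈ Icc (0 : ℝ) T, HasDerivWithinAt (fun t => R t *ᵥ X t)
      ((-(A t)ᵀ + R t * (B * U⁻¹ * Bᵀ)) *ᵥ (R t *ᵥ X t)) (Icc 0 T) t := by
    intro t ht
    have h1 : HasDerivWithinAt (fun t => R t *ᵥ X t)
        ((-(Cᵀ * C) - (A t)ᵀ * R t - R t * A t + R t * B * U⁻¹ * Bᵀ * R t) *ᵥ X t
          + R t *ᵥ (A t *ᵥ X t)) (Icc 0 T) t := by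
      refine hasDerivWithinAt_pi.2 fun i => ?_
      have hXi := hasDerivWithinAt_pi.1 (hX.2 t ht)
      have := HasDerivWithinAt.fun_sum (u := Finset.univ) fun j _ =>
        (hR.2 t ht i j).mul (hXi j)
      refine this.congr_deriv ?_
      rw [Finset.sum_add_distrib]
      rfl
    refine h1.congr_deriv ?_
    have h2 : (Cᵀ * C) *ᵥ X t = 0 := by
      rw [← Matrix.mulVec_mulVec, hCX t ht, Matrix.mulVec_zero]
    simp only [Matrix.add_mulVec, Matrix.sub_mulVec, Matrix.neg_mulVec, h2, Matrix.mulVec_mulVec,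
      Matrix.mul_assoc, Matrix.add_mul, Matrix.neg_mul]
    abel
  have h0 := eq_zero_of_norm_deriv_le_of_terminal_eq_zero hT hd (fun t ht => hK t ht _)
    (by simp [hR.1])
  rw [← hX.1]
  exact (Matrix.mulVec_injective_iff_isUnit.2 hR0) (by simpa using h0)

/-! ### The mesh, discrete Gronwall and forward differences -/

lemma div_natCast_mul_le {T : ℝ} (hT : 0 ≤ T) (n : ℕ) : T / n * n ≤ T := by
  rcases Nat.eq_zero_or_pos n with rfl | hn
  · simpa using hT
  · exact (div_mul_cancel₀ T (by exact_mod_cast hn.ne')).le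

lemma meshTime_succ (T : ℝ) (n i : ℕ) : meshTime T n (i + 1) = meshTime T n i + T / n := by
  simp only [meshTime]; push_cast; ring

lemma meshTime_self (T : ℝ) {n : ℕ} (hn : n ≠ 0) : meshTime T n n = T := by
  have : (n : ℝ) ≠ 0 := by exact_mod_cast hn
  simp only [meshTime]; field_simp

lemma meshTime_mem_Icc {T : ℝ} (hT : 0 ≤ T) {n i : ℕ} (hi : i ≤ n) :
    meshTime T n i ∈ Icc 0 T := by
  refine ⟨by unfold meshTime; positivity, ?_⟩
  rcases Nat.eq_zero_or_pos n with rfl | hn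
  · simpa [meshTime] using hT
  · calc meshTime T n i ≤ n * (T / n) := by unfold meshTime; gcongr
      _ = T := meshTime_self T hn.ne'

/-- Discrete Gronwall inequality: the one-step factors multiply to `(1 + Δ M) ^ i ≤ exp (M t_i) ≤
exp (M T)`. Each forcing term is given the full power, which is at least one, so that the sum
factors. -/
lemma le_exp_mul_of_le_one_add_mul {n : ℕ} {T M : ℝ} (hT : 0 ≤ T) (hM : 0 ≤ M) {a b : ℕ → ℝ}
    (ha : 0 ≤ a 0) (hb : ∀ i, 0 ≤ b i)
    (h : ∀ i < n, a (i + 1) ≤ (1 + T / n * M) * a i + T / n * b i) :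
    ∀ i ≤ n, a i ≤ Real.exp (M * T) * (a 0 + T / n * ∑ j ∈ Finset.range n, b j) := by
  intro i hi
  have h0 : 0 ≤ T / n * M := by positivity
  have hS : ∀ k, 0 ≤ ∑ j ∈ Finset.range k, b j := fun k => Finset.sum_nonneg fun j _ => hb j
  have key : a i ≤ (1 + T / n * M) ^ i * (a 0 + T / n * ∑ j ∈ Finset.range i, b j) := by
    induction i with
    | zero => simp
    | succ i ih =>
      have h1 : (1 : ℝ) ≤ (1 + T / n * M) ^ (i + 1) := one_le_pow₀ (by linarith)
      have h2 : 0 ≤ T / n * b i := mul_nonneg (by positivity) (hb i)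
      calc a (i + 1) ≤ (1 + T / n * M) * a i + T / n * b i := h i hi
        _ ≤ (1 + T / n * M) * ((1 + T / n * M) ^ i *
              (a 0 + T / n * ∑ j ∈ Finset.range i, b j)) + T / n * b i := by
            gcongr
            exact ih (by omega)
        _ ≤ (1 + T / n * M) * ((1 + T / n * M) ^ i *
              (a 0 + T / n * ∑ j ∈ Finset.range i, b j))
              + (1 + T / n * M) ^ (i + 1) * (T / n * b i) := by
            exact add_le_add le_rfl (le_mul_of_one_le_left h2 h1)
        _ = _ := by rw [Finset.sum_range_succ]; ring
  have hpow : (1 + T / n * M) ^ i ≤ Real.exp (M * T) := by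
    calc (1 + T / n * M) ^ i ≤ Real.exp (T / n * M) ^ i := by
          gcongr
          linarith [Real.add_one_le_exp (T / n * M)]
      _ = Real.exp (M * meshTime T n i) := by
          rw [← Real.exp_nat_mul, meshTime]; ring_nf
      _ ≤ _ := by
          gcongr
          exact (meshTime_mem_Icc hT hi).2
  have hsum : ∑ j ∈ Finset.range i, b j ≤ ∑ j ∈ Finset.range n, b j :=
    Finset.sum_le_sum_of_subset_of_nonneg (Finset.range_mono hi) fun j _ _ => hb j
  have hTn : 0 ≤ T / n := by positivity
  refine key.trans (mul_le_mul hpow (by gcongr) ?_ (Real.exp_pos _).le)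
  exact add_nonneg ha (mul_nonneg hTn (hS i))

/-- Forward differences over the mesh are uniformly close to the derivative. -/
lemma eventually_norm_mesh_sub_le {E : Type*} [NormedAddCommGroup E] [NormedSpace ℝ E] {T : ℝ}
    (hT : 0 < T) {f f' : ℝ → E}
    (hf : ∀ t ∈ Icc (0 : ℝ) T, HasDerivWithinAt f (f' t) (Icc 0 T) t)
    (hf' : ContinuousOn f' (Icc 0 T)) {η : ℝ} (hη : 0 < η) :
    ∀ᶠ n : ℕ in atTop, ∀ i < n, ‖f (meshTime T n (i + 1)) - f (meshTime T n i)
      - (T / n) • f' (meshTime T n i)‖ ≤ T / n * η := by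
  have huc := isCompact_Icc.uniformContinuousOn_of_continuous hf'
  obtain ⟨δ, hδ, H⟩ := Metric.uniformContinuousOn_iff.1 huc η hη
  have hlim : Tendsto (fun n : ℕ => T / (n : ℝ)) atTop (𝓝 0) :=
    tendsto_const_div_atTop_nhds_zero_nat T
  filter_upwards [hlim.eventually (gt_mem_nhds hδ)] with n hn i hi
  have hs := meshTime_mem_Icc hT.le hi.le
  have hs' := meshTime_mem_Icc hT.le (show i + 1 ≤ n from hi)
  have hstep := meshTime_succ T n i
  have hTn : 0 ≤ T / n := by positivity
  set s := meshTime T n i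
  set s' := meshTime T n (i + 1)
  have hsub : Icc s s' ⊆ Icc 0 T := Icc_subset_Icc hs.1 hs'.2
  -- Subtracting the linear function of slope `f' s` leaves a function whose derivative on the cell
  -- is at most `η`, by uniform continuity of `f'`.
  have hd : ∀ t ∈ Icc s s', HasDerivWithinAt (fun t => f t - t • f' s) (f' t - f' s)
      (Icc s s') t := fun t ht => by
    have := ((hf t (hsub ht)).mono hsub).sub
      (((hasDerivAt_id t).smul_const (f' s)).hasDerivWithinAt (s := Icc s s'))
    simpa [Pi.sub_def] using this
  have := Convex.norm_image_sub_le_of_norm_hasDerivWithin_le hd (C := η) (fun t ht => by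
    rw [← dist_eq_norm]
    refine (H t (hsub ht) s hs ?_).le
    rw [Real.dist_eq, abs_of_nonneg (by linarith [ht.1])]
    linarith [ht.2]) (convex_Icc _ _)
    (left_mem_Icc.2 (by linarith)) (right_mem_Icc.2 (by linarith))
  have e1 : s' - s = T / n := by linarith
  rw [e1, Real.norm_of_nonneg hTn, mul_comm η] at this
  refine le_trans (le_of_eq ?_) this
  rw [← e1, sub_smul]
  congr 1
  abel

/-! ### Partial sums of the noise -/

/-- Summation by parts against a sequence with small normalised partial sums. -/
lemma abs_mul_sum_inner_le {H : Type*} [NormedAddCommGroup H] [InnerProductSpace ℝ H] {n : ℕ}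
    {c D : ℝ} (hc : 0 ≤ c) {w : ℕ → H} (Z : ℕ → H)
    (hw : ∀ k ≤ n + 1, c * ‖∑ j ∈ Finset.range k, w j‖ ≤ D) :
    |c * ∑ i ∈ Finset.range (n + 1), inner ℝ (Z i) (w i)| ≤
      D * (‖Z n‖ + ∑ i ∈ Finset.range n, ‖Z (i + 1) - Z i‖) := by
  set W : ℕ → H := fun k => ∑ j ∈ Finset.range k, w j
  have hparts : ∀ m, ∑ i ∈ Finset.range (m + 1), inner ℝ (Z i) (w i) =
      inner ℝ (Z m) (W (m + 1)) - ∑ i ∈ Finset.range m, inner ℝ (Z (i + 1) - Z i) (W (i + 1)) := by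
    intro m
    induction m with
    | zero => simp [W]
    | succ m ih =>
      rw [Finset.sum_range_succ, ih, Finset.sum_range_succ _ m]
      have : W (m + 1 + 1) = W (m + 1) + w (m + 1) := Finset.sum_range_succ _ _
      rw [this, inner_add_right, inner_sub_left]
      ring
  have hin : ∀ k ≤ n + 1, ∀ z : H, |c * inner ℝ z (W k)| ≤ D * ‖z‖ := by
    intro k hk z
    rw [abs_mul, abs_of_nonneg hc]
    calc c * |inner ℝ z (W k)| ≤ c * (‖z‖ * ‖W k‖) := by
          gcongr
          exact abs_real_inner_le_norm _ _
      _ = (c * ‖W k‖) * ‖z‖ := by ring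
      _ ≤ _ := by
          gcongr
          exact hw k hk
  rw [hparts, mul_sub, Finset.mul_sum, mul_add, Finset.mul_sum]
  refine (abs_sub _ _).trans (add_le_add (hin _ le_rfl _) ?_)
  refine (Finset.abs_sum_le_sum_abs _ _).trans (Finset.sum_le_sum fun i hi => ?_)
  exact hin _ (by have := Finset.mem_range.1 hi; omega) _

/-- Summation by parts needs all partial sums up to `n + 1` at once. From `W n / n → 0` one gets `‖W
k‖ ≤ K + η' k` for every `k`, the constant `K` absorbing the finitely many early terms. -/
lemma exists_tendsto_zero_forall_norm_partialSum_le {H : Type*} [NormedAddCommGroup H]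
    [NormedSpace ℝ H] {T : ℝ} (hT : 0 ≤ T) {W : ℕ → H}
    (hW : Tendsto (fun n : ℕ => (n : ℝ)⁻¹ • W n) atTop (𝓝 0)) :
    ∃ D : ℕ → ℝ, Tendsto D atTop (𝓝 0) ∧ ∀ n, ∀ k ≤ n + 1, T / n * ‖W k‖ ≤ D n := by
  have hne : ∀ n : ℕ, (Finset.range (n + 2)).Nonempty := fun n => ⟨0, by simp⟩
  refine ⟨fun n => (Finset.range (n + 2)).sup' (hne n) fun k => T / n * ‖W k‖, ?_,
    fun n k hk => Finset.le_sup' (fun k => T / n * ‖W k‖) (by simp; omega)⟩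
  rw [Metric.tendsto_atTop]
  intro η hη
  have hη' : 0 < η / (4 * (T + 1)) := by positivity
  obtain ⟨N, hN⟩ := Metric.tendsto_atTop.1 hW _ hη'
  -- With `k ≤ n + 1 ≤ 2n` the linear part contributes `2 T η' < η / 2`; the constant part `T K / n`
  -- takes the other half.
  set η' := η / (4 * (T + 1)) with hη'def
  set K : ℝ := ∑ k ∈ Finset.range (N + 1), ‖W k‖
  have hbound : ∀ k, ‖W k‖ ≤ K + η' * k := by
    intro k
    rcases Nat.lt_or_ge k (N + 1) with hk | hk
    · have := Finset.single_le_sum (f := fun k => ‖W k‖) (fun _ _ => norm_nonneg _)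
        (Finset.mem_range.2 hk)
      have h2 : 0 ≤ η' * k := by positivity
      exact this.trans (by linarith)
    · have hkpos : (0 : ℝ) < k := by exact_mod_cast (by omega : 0 < k)
      have := hN k (by omega)
      rw [dist_zero_right, norm_smul, norm_inv, Real.norm_of_nonneg hkpos.le,
        inv_mul_lt_iff₀ hkpos] at this
      have hK : 0 ≤ K := by positivity
      linarith
  have hlim : Tendsto (fun n : ℕ => (T * K) / (n : ℝ)) atTop (𝓝 0) :=
    tendsto_const_div_atTop_nhds_zero_nat _
  obtain ⟨N', hN'⟩ := eventually_atTop.1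
    ((hlim.eventually (gt_mem_nhds (half_pos hη))).and (eventually_ge_atTop 1))
  refine ⟨N', fun n hn => ?_⟩
  obtain ⟨h1, h2⟩ := hN' n hn
  have hnpos : (0 : ℝ) < n := by exact_mod_cast h2
  have hn1 : (1 : ℝ) ≤ n := by exact_mod_cast h2
  have hnonneg : 0 ≤ (Finset.range (n + 2)).sup' (hne n) fun k => T / n * ‖W k‖ :=
    le_trans (by positivity) (Finset.le_sup' (fun k => T / n * ‖W k‖)
      (Finset.mem_range.2 (by omega : 0 < n + 2)))
  rw [Real.dist_0_eq_abs, abs_of_nonneg hnonneg, Finset.sup'_lt_iff]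
  intro k hk
  have hk' : (k : ℝ) ≤ n + 1 := by
    have : k ≤ n + 1 := by have := Finset.mem_range.1 hk; omega
    exact_mod_cast this
  have hTη : T * η' < η / 4 := by
    rw [hη'def, mul_div_assoc', div_lt_div_iff₀ (by positivity) (by norm_num)]
    nlinarith
  calc T / n * ‖W k‖ ≤ T / n * (K + η' * (n + n)) := by
        gcongr
        refine (hbound k).trans ?_
        gcongr
        linarith
    _ = T * K / n + 2 * (T * η') := by field_simp; ring
    _ < η := by linarith

/-! ### Riemann sums -/

/-- A nonnegative continuous function whose Riemann sums tend to zero along a sequence of meshes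
vanishes. -/
lemma eq_zero_of_tendsto_riemannSum {T : ℝ} (hT : 0 < T) {f : ℝ → ℝ}
    (hf : ContinuousOn f (Icc 0 T)) (hf0 : ∀ t ∈ Icc (0 : ℝ) T, 0 ≤ f t) {N : ℕ → ℕ}
    (hN : Tendsto N atTop atTop)
    (hlim : Tendsto (fun k => T / N k * ∑ i ∈ Finset.range (N k), f (meshTime T (N k) i))
      atTop (𝓝 0)) : ∀ t ∈ Icc (0 : ℝ) T, f t = 0 := by
  have hd : ∀ t ∈ Icc (0 : ℝ) T,
      HasDerivWithinAt (fun t => ∫ s in (0 : ℝ)..t, f s) (f t) (Icc 0 T) t := by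
    intro t ht
    have : Fact (t ∈ Icc (0 : ℝ) T) := ⟨ht⟩
    refine intervalIntegral.integral_hasDerivWithinAt_right ?_ ?_ (hf t ht)
    · exact (hf.mono (Icc_subset_Icc le_rfl ht.2)).intervalIntegrable_of_Icc ht.1
    · exact hf.stronglyMeasurableAtFilter_nhdsWithin measurableSet_Icc t
  -- The increments of the primitive over the mesh are `Δ f(t_i)` up to `Δ η / (2T)`, so the
  -- integral exceeds a Riemann sum by at most `η / 2`.
  have hint : ∫ s in (0 : ℝ)..T, f s ≤ 0 := by
    refine le_of_forall_pos_le_add fun η hη => ?_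
    have hη2 : 0 < η / (2 * T) := by positivity
    have h1 := hN.eventually (eventually_norm_mesh_sub_le hT hd hf hη2)
    have h2 := hlim.eventually (gt_mem_nhds (half_pos hη))
    obtain ⟨k, h1, h2, h3⟩ := (h1.and (h2.and (hN.eventually (eventually_ge_atTop 1)))).exists
    set n := N k
    have hn : n ≠ 0 := by omega
    have hn' : (n : ℝ) ≠ 0 := by exact_mod_cast hn
    have htel := Finset.sum_range_sub (fun i => ∫ s in (0 : ℝ)..meshTime T n i, f s) n
    rw [meshTime_self T hn] at htel
    have h0 : meshTime T n 0 = 0 := by simp [meshTime]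
    rw [h0, intervalIntegral.integral_same, sub_zero] at htel
    rw [← htel]
    calc _ ≤ ∑ i ∈ Finset.range n, (T / n * f (meshTime T n i) + T / n * (η / (2 * T))) := by
          refine Finset.sum_le_sum fun i hi => ?_
          have := (le_abs_self _).trans (h1 i (Finset.mem_range.1 hi))
          simp only [smul_eq_mul] at this
          linarith
      _ = T / n * (∑ i ∈ Finset.range n, f (meshTime T n i)) + η / 2 := by
          rw [Finset.sum_add_distrib, ← Finset.mul_sum]
          simp only [Finset.sum_const, Finset.card_range, nsmul_eq_mul]
          field_simp
      _ ≤ 0 + η := by linarith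
  intro t ht
  by_contra hne
  have hpos : 0 < ∫ s in (0 : ℝ)..T, f s :=
    intervalIntegral.integral_pos hT hf (fun s hs => hf0 s (Ioc_subset_Icc_self hs))
      ⟨t, ht, lt_of_le_of_ne (hf0 t ht) (Ne.symm hne)⟩
  linarith

/-! ### Stability of the finite difference scheme -/

section Trajectory

variable {d du : ℕ} {T : ℝ} {n : ℕ} {A : ℝ → Matrix (Fin d) (Fin d) ℝ}
  {B : Matrix (Fin d) (Fin du) ℝ}

/-- This homogeneity permits near-minimisers with unbounded initial conditions to be renormalised.
-/
lemma discreteTrajectory_smul (c : ℝ) (x₀ : Fin d → ℝ) (u : ℕ → Fin du → ℝ) (i : ℕ) :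
    discreteTrajectory T n A B (c • x₀) (c • u) i = c • discreteTrajectory T n A B x₀ u i := by
  induction i with
  | zero => rfl
  | succ i ih =>
    simp only [discreteTrajectory, ih, Pi.smul_apply, Matrix.mulVec_smul, smul_add]
    rw [smul_comm c (T / (n : ℝ))]

lemma discreteTrajectory_succ_sub (x₀ : Fin d → ℝ) (u : ℕ → Fin du → ℝ) (i : ℕ) :
    discreteTrajectory T n A B x₀ u (i + 1) - discreteTrajectory T n A B x₀ u i =
      (T / n) • (A (meshTime T n i) *ᵥ discreteTrajectory T n A B x₀ u i + B *ᵥ u i) := by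
  simp only [discreteTrajectory, Matrix.add_mulVec, Matrix.one_mulVec, Matrix.smul_mulVec,
    smul_add]
  abel

variable {M b : ℝ}

/-- Stability of the finite difference scheme. -/
lemma norm_discreteTrajectory_sub_le (hT : 0 ≤ T) (hM : 0 ≤ M)
    (hA : ∀ t ∈ Icc (0 : ℝ) T, ∀ x, ‖A t *ᵥ x‖ ≤ M * ‖x‖) (hb : 0 ≤ b)
    (hB : ∀ v, ‖B *ᵥ v‖ ≤ b * ‖v‖) {X : ℝ → Fin d → ℝ} {r : ℝ} (hr : 0 ≤ r)
    (hX : ∀ i < n, ‖X (meshTime T n (i + 1)) - X (meshTime T n i)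
      - (T / n) • (A (meshTime T n i) *ᵥ X (meshTime T n i))‖ ≤ T / n * r)
    (x₀ : Fin d → ℝ) (u : ℕ → Fin du → ℝ) {i : ℕ} (hi : i ≤ n) :
    ‖discreteTrajectory T n A B x₀ u i - X (meshTime T n i)‖ ≤
      Real.exp (M * T) * (‖x₀ - X 0‖ + T * r + b * (T / n * ∑ j ∈ Finset.range n, ‖u j‖)) := by
  have hTn : 0 ≤ T / n := by positivity
  have := le_exp_mul_of_le_one_add_mul hT hM (n := n)
    (a := fun i => ‖discreteTrajectory T n A B x₀ u i - X (meshTime T n i)‖)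
    (b := fun i => r + b * ‖u i‖) (norm_nonneg _) (fun i => by positivity) (fun i hi => ?_) i hi
  · refine this.trans ?_
    have h0 : meshTime T n 0 = 0 := by simp [meshTime]
    have hnT : T / n * (n * r) ≤ T * r := by
      rw [← mul_assoc]
      gcongr
      exact div_natCast_mul_le hT n
    refine mul_le_mul_of_nonneg_left ?_ (Real.exp_pos _).le
    simp only [Finset.sum_add_distrib, Finset.sum_const, Finset.card_range, nsmul_eq_mul,
      ← Finset.mul_sum, h0, discreteTrajectory]
    rw [mul_add, mul_left_comm _ b]
    linarith
  · set t := meshTime T n i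
    set z := discreteTrajectory T n A B x₀ u i
    have e : discreteTrajectory T n A B x₀ u (i + 1) - X (meshTime T n (i + 1)) =
        (z - X t) + (T / n) • (A t *ᵥ (z - X t)) + (T / n) • (B *ᵥ u i)
          - (X (meshTime T n (i + 1)) - X t - (T / n) • (A t *ᵥ X t)) := by
      have := discreteTrajectory_succ_sub (T := T) (n := n) (A := A) (B := B) x₀ u i
      rw [sub_eq_iff_eq_add] at this
      rw [this, Matrix.mulVec_sub, smul_add, smul_sub]
      abel
    calc _ ≤ ‖z - X t‖ + ‖(T / n) • (A t *ᵥ (z - X t))‖ + ‖(T / n) • (B *ᵥ u i)‖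
          + ‖X (meshTime T n (i + 1)) - X t - (T / n) • (A t *ᵥ X t)‖ := by
          rw [e]
          exact (norm_sub_le _ _).trans (by gcongr; exact norm_add₃_le)
      _ ≤ ‖z - X t‖ + T / n * (M * ‖z - X t‖) + T / n * (b * ‖u i‖) + T / n * r := by
          rw [norm_smul, norm_smul, Real.norm_of_nonneg hTn]
          gcongr
          · exact hA t (meshTime_mem_Icc hT hi.le) _
          · exact hB _
          · exact hX i hi
      _ = _ := by ring

/-- Stability around the zero curve, which has no consistency error. -/
lemma norm_discreteTrajectory_le (hT : 0 ≤ T) (hM : 0 ≤ M)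
    (hA : ∀ t ∈ Icc (0 : ℝ) T, ∀ x, ‖A t *ᵥ x‖ ≤ M * ‖x‖) (hb : 0 ≤ b)
    (hB : ∀ v, ‖B *ᵥ v‖ ≤ b * ‖v‖) (x₀ : Fin d → ℝ) (u : ℕ → Fin du → ℝ) {i : ℕ} (hi : i ≤ n) :
    ‖discreteTrajectory T n A B x₀ u i‖ ≤
      Real.exp (M * T) * (‖x₀‖ + b * (T / n * ∑ j ∈ Finset.range n, ‖u j‖)) := by
  simpa using norm_discreteTrajectory_sub_le hT hM hA hb hB (X := fun _ => 0) (r := 0) le_rfl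
    (by simp) x₀ u hi

/-- The endpoint plus the total variation of a discrete trajectory is controlled by the data. -/
lemma norm_add_variation_discreteTrajectory_le (hT : 0 ≤ T) (hM : 0 ≤ M)
    (hA : ∀ t ∈ Icc (0 : ℝ) T, ∀ x, ‖A t *ᵥ x‖ ≤ M * ‖x‖) (hb : 0 ≤ b)
    (hB : ∀ v, ‖B *ᵥ v‖ ≤ b * ‖v‖) (x₀ : Fin d → ℝ) (u : ℕ → Fin du → ℝ) :
    ‖discreteTrajectory T n A B x₀ u n‖ + ∑ i ∈ Finset.range n,
        ‖discreteTrajectory T n A B x₀ u (i + 1) - discreteTrajectory T n A B x₀ u i‖ ≤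
      ((1 + T * M) * Real.exp (M * T) + 1) *
        (‖x₀‖ + b * (T / n * ∑ j ∈ Finset.range n, ‖u j‖)) := by
  have hTn : 0 ≤ T / n := by positivity
  set v := T / n * ∑ j ∈ Finset.range n, ‖u j‖ with hv
  set S := Real.exp (M * T) * (‖x₀‖ + b * v)
  have hS : ∀ i ≤ n, ‖discreteTrajectory T n A B x₀ u i‖ ≤ S := fun i hi =>
    norm_discreteTrajectory_le hT hM hA hb hB x₀ u hi
  have hS0 : 0 ≤ S := (norm_nonneg _).trans (hS n le_rfl)
  have hvar : ∑ i ∈ Finset.range n,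
      ‖discreteTrajectory T n A B x₀ u (i + 1) - discreteTrajectory T n A B x₀ u i‖ ≤
      T * (M * S) + b * v := by
    calc _ ≤ ∑ i ∈ Finset.range n, T / n * (M * S + b * ‖u i‖) := by
          refine Finset.sum_le_sum fun i hi => ?_
          have hi' := Finset.mem_range.1 hi
          rw [discreteTrajectory_succ_sub, norm_smul, Real.norm_of_nonneg hTn]
          gcongr
          refine (norm_add_le _ _).trans (add_le_add ?_ (hB _))
          exact (hA _ (meshTime_mem_Icc hT hi'.le) _).trans (by gcongr; exact hS i hi'.le)
      _ = T / n * n * (M * S) + b * v := by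
          rw [← Finset.mul_sum, Finset.sum_add_distrib, ← Finset.mul_sum _ _ b, hv]
          simp only [Finset.sum_const, Finset.card_range, nsmul_eq_mul]
          ring
      _ ≤ _ := by
          gcongr
          exact div_natCast_mul_le hT n
  have hx : 0 ≤ ‖x₀‖ := norm_nonneg _
  calc _ ≤ S + (T * (M * S) + b * v) := add_le_add (hS n le_rfl) hvar
    _ ≤ (1 + T * M) * S + (‖x₀‖ + b * v) := by linarith
    _ = _ := by simp only [S]; ring

end Trajectory

/-! ### Convergence of the scheme under perturbed coefficients -/

lemma exists_tendsto_zero_forall_le {N : ℕ → ℕ} {a : ℕ → ℕ → ℝ} (ha : ∀ k i, 0 ≤ a k i)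
    (h : ∀ η > 0, ∀ᶠ k in atTop, ∀ i ≤ N k, a k i ≤ η) :
    ∃ ρ : ℕ → ℝ, Tendsto ρ atTop (𝓝 0) ∧ ∀ k, ∀ i ≤ N k, a k i ≤ ρ k := by
  have hne : ∀ k, (Finset.range (N k + 1)).Nonempty := fun k => ⟨0, by simp⟩
  have hle : ∀ k, ∀ i ≤ N k, a k i ≤ (Finset.range (N k + 1)).sup' (hne k) (a k) :=
    fun k i hi => Finset.le_sup' (a k) (Finset.mem_range.2 (by omega))
  refine ⟨fun k => (Finset.range (N k + 1)).sup' (hne k) (a k), ?_, hle⟩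
  rw [Metric.tendsto_nhds]
  intro η hη
  filter_upwards [h (η / 2) (half_pos hη)] with k hk
  rw [Real.dist_0_eq_abs, abs_of_nonneg ((ha k 0).trans (hle k 0 (Nat.zero_le _))),
    Finset.sup'_lt_iff]
  intro i hi
  have := hk i (by have := Finset.mem_range.1 hi; omega)
  linarith

/-- The quadratic form attains a positive minimum on the compact unit sphere; homogeneity does the
rest. The sphere is empty when `m = 0`, hence the case split. -/
lemma exists_mul_norm_sq_le_dotProduct {m : ℕ} {U : Matrix (Fin m) (Fin m) ℝ} (hU : U.PosDef) :
    ∃ κ : ℝ, 0 < κ ∧ ∀ v : Fin m → ℝ, κ * ‖v‖ ^ 2 ≤ v ⬝ᵥ (U *ᵥ v) := by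
  rcases (Metric.sphere (0 : Fin m → ℝ) 1).eq_empty_or_nonempty with he | hne
  · refine ⟨1, one_pos, fun v => ?_⟩
    have hv : v = 0 := by
      by_contra hv
      have : (‖v‖⁻¹ • v) ∈ Metric.sphere (0 : Fin m → ℝ) 1 := by
        simp [norm_smul, norm_ne_zero_iff.2 hv]
      rw [he] at this
      exact this
    simp [hv]
  · have hc : Continuous fun v : Fin m → ℝ => v ⬝ᵥ (U *ᵥ v) := by fun_prop
    obtain ⟨v₀, hv₀, hmin⟩ := (isCompact_sphere (0 : Fin m → ℝ) 1).exists_isMinOn hne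
      hc.continuousOn
    have hv₀' : v₀ ≠ 0 := fun h => by simp [h] at hv₀
    refine ⟨v₀ ⬝ᵥ (U *ᵥ v₀), by simpa using hU.dotProduct_mulVec_pos hv₀', fun v => ?_⟩
    rcases eq_or_ne v 0 with rfl | hv
    · simp
    have hn : ‖v‖ ≠ 0 := norm_ne_zero_iff.2 hv
    have hmem : (‖v‖⁻¹ • v) ∈ Metric.sphere (0 : Fin m → ℝ) 1 := by simp [norm_smul, hn]
    have := hmin hmem
    simp only [mem_ofPred_eq, Matrix.mulVec_smul, dotProduct_smul, smul_dotProduct,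
      smul_eq_mul] at this
    calc _ ≤ (‖v‖⁻¹ * (‖v‖⁻¹ * (v ⬝ᵥ (U *ᵥ v)))) * ‖v‖ ^ 2 := by gcongr
      _ = _ := by field_simp

/-- Uniform convergence of the coefficients, in terms of the associated linear maps. -/
lemma eventually_norm_sub_mulVec_le {ι : Type*} {l : Filter ι} {m n : ℕ} {s : Set ℝ}
    {A : ι → ℝ → Matrix (Fin m) (Fin n) ℝ} {A₀ : ℝ → Matrix (Fin m) (Fin n) ℝ}
    (h : TendstoUniformlyOn A A₀ l s) {η : ℝ} (hη : 0 < η) :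
    ∀ᶠ k in l, ∀ t ∈ s, ∀ x, ‖(A k t - A₀ t) *ᵥ x‖ ≤ η * ‖x‖ := by
  -- A row sums `n` entries; the extra one in the denominator covers `n = 0`.
  have hη' : 0 < η / (n + 1) := by positivity
  have key : ∀ i j, ∀ᶠ k in l, ∀ t ∈ s, dist (A₀ t i j) (A k t i j) < η / (n + 1) := by
    intro i j
    have huc : UniformContinuous fun D : Matrix (Fin m) (Fin n) ℝ => D i j :=
      (Pi.uniformContinuous_proj (fun _ : Fin n => ℝ) j).comp
        (Pi.uniformContinuous_proj (fun _ : Fin m => Fin n → ℝ) i)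
    exact Metric.tendstoUniformlyOn_iff.1 (huc.comp_tendstoUniformlyOn h) _ hη'
  filter_upwards [eventually_all.2 fun i => eventually_all.2 fun j => key i j] with k hk t ht x
  have := norm_mulVec_le_of_abs_le (A := A k t - A₀ t) hη'.le (fun i j => by
    have := (hk i j t ht).le
    rwa [dist_comm, Real.dist_eq] at this) x
  refine this.trans ?_
  gcongr
  rw [mul_div_assoc', div_le_iff₀ (by positivity)]
  nlinarith

section Convergence

variable {d du : ℕ} {T : ℝ} {B : Matrix (Fin d) (Fin du) ℝ}

lemma eventually_norm_mulVec_le_of_close {A : ℕ → ℝ → Matrix (Fin d) (Fin d) ℝ}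
    {A₀ : ℝ → Matrix (Fin d) (Fin d) ℝ}
    (hA : ∀ η > 0, ∀ᶠ k in atTop, ∀ t ∈ Icc (0 : ℝ) T, ∀ x, ‖(A k t - A₀ t) *ᵥ x‖ ≤ η * ‖x‖)
    {M : ℝ} (hM : ∀ t ∈ Icc (0 : ℝ) T, ∀ x, ‖A₀ t *ᵥ x‖ ≤ M * ‖x‖) :
    ∀ᶠ k in atTop, ∀ t ∈ Icc (0 : ℝ) T, ∀ x, ‖A k t *ᵥ x‖ ≤ (M + 1) * ‖x‖ := by
  filter_upwards [hA 1 one_pos] with k hk t ht x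
  have e : A k t *ᵥ x = A₀ t *ᵥ x + (A k t - A₀ t) *ᵥ x := by
    rw [Matrix.sub_mulVec]; abel
  rw [e, add_mul]
  exact (norm_add_le _ _).trans (add_le_add (hM t ht x) (hk t ht x))

/-- Convergence of the finite difference scheme when coefficients, initial conditions and controls
converge. -/
lemma exists_tendsto_zero_norm_discreteTrajectory_sub_le (hT : 0 < T)
    {A : ℕ → ℝ → Matrix (Fin d) (Fin d) ℝ} {A₀ : ℝ → Matrix (Fin d) (Fin d) ℝ}
    (hA₀ : ∀ i j, ContinuousOn (fun t => A₀ t i j) (Icc 0 T))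
    (hA : ∀ η > 0, ∀ᶠ k in atTop, ∀ t ∈ Icc (0 : ℝ) T, ∀ x, ‖(A k t - A₀ t) *ᵥ x‖ ≤ η * ‖x‖)
    {N : ℕ → ℕ} (hN : Tendsto N atTop atTop) {x₀ : Fin d → ℝ} {X : ℝ → Fin d → ℝ}
    (hX : IsSolution T A₀ x₀ X) {x : ℕ → Fin d → ℝ} (hx : Tendsto x atTop (𝓝 x₀))
    {u : ℕ → ℕ → Fin du → ℝ}
    (hu : Tendsto (fun k => T / N k * ∑ j ∈ Finset.range (N k), ‖u k j‖) atTop (𝓝 0)) :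
    ∃ ρ : ℕ → ℝ, Tendsto ρ atTop (𝓝 0) ∧ ∀ k, ∀ i ≤ N k,
      ‖discreteTrajectory T (N k) (A k) B (x k) (u k) i - X (meshTime T (N k) i)‖ ≤ ρ k := by
  refine exists_tendsto_zero_forall_le (fun _ _ => norm_nonneg _) fun η hη => ?_
  obtain ⟨M, hM0, hM⟩ := exists_norm_mulVec_le hA₀
  set b := ‖LinearMap.toContinuousLinearMap B.mulVecLin‖
  have hB : ∀ v, ‖B *ᵥ v‖ ≤ b * ‖v‖ := fun v =>
    (LinearMap.toContinuousLinearMap B.mulVecLin).le_opNorm v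
  obtain ⟨S, hS⟩ := isCompact_Icc.exists_bound_of_continuousOn hX.continuousOn
  have hS0 : 0 ≤ S := (norm_nonneg _).trans (hS 0 ⟨le_rfl, hT.le⟩)
  set K := Real.exp ((M + 1) * T)
  have hK : 0 < K := Real.exp_pos _
  -- Chosen so that `K * (T * r) = η / 2`. Half of `r` pays for discretising `X`, half for replacing
  -- `A₀` by `A k`.
  set r := η / (2 * K * T)
  have hr : 0 < r := by positivity
  have h1 := hN.eventually (eventually_norm_mesh_sub_le hT hX.2
    (continuousOn_mulVec hA₀ hX.continuousOn) (half_pos hr))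
  have h2 := hA (r / (2 * (S + 1))) (by positivity)
  have h3 := eventually_norm_mulVec_le_of_close hA hM
  have h4 : Tendsto (fun k => K * (‖x k - x₀‖ +
      b * (T / N k * ∑ j ∈ Finset.range (N k), ‖u k j‖))) atTop (𝓝 0) := by
    have := ((tendsto_iff_norm_sub_tendsto_zero.1 hx).add (hu.const_mul b)).const_mul K
    simpa using this
  filter_upwards [h1, h2, h3, h4.eventually (gt_mem_nhds (half_pos hη))] with k h1 h2 h3 h4 i hi
  have hTn : 0 ≤ T / N k := by positivity
  have hrem : ∀ i < N k, ‖X (meshTime T (N k) (i + 1)) - X (meshTime T (N k) i)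
      - (T / N k) • (A k (meshTime T (N k) i) *ᵥ X (meshTime T (N k) i))‖ ≤ T / N k * r := by
    intro i hi
    have ht := meshTime_mem_Icc hT.le hi.le
    set t := meshTime T (N k) i
    have e : X (meshTime T (N k) (i + 1)) - X t - (T / N k) • (A k t *ᵥ X t) =
        (X (meshTime T (N k) (i + 1)) - X t - (T / N k) • (A₀ t *ᵥ X t))
          - (T / N k) • ((A k t - A₀ t) *ᵥ X t) := by
      rw [Matrix.sub_mulVec, smul_sub]; abel
    have h5 : ‖(A k t - A₀ t) *ᵥ X t‖ ≤ r / 2 := by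
      calc _ ≤ r / (2 * (S + 1)) * (S + 1) := by
            refine (h2 t ht _).trans ?_
            gcongr
            linarith [hS t ht]
        _ = r / 2 := by field_simp
    calc _ ≤ T / N k * (r / 2) + T / N k * (r / 2) := by
          rw [e]
          refine (norm_sub_le _ _).trans (add_le_add (h1 i hi) ?_)
          rw [norm_smul, Real.norm_of_nonneg hTn]
          gcongr
      _ = _ := by ring
  have := norm_discreteTrajectory_sub_le (B := B) hT.le (by positivity) h3 (norm_nonneg _) hB hr.le
    hrem (x k) (u k) hi
  rw [hX.1] at this
  refine this.trans ?_
  have e : K * (T * r) = η / 2 := by simp only [r]; field_simp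
  change K * _ ≤ _
  calc _ = K * (‖x k - x₀‖ + b * (T / N k * ∑ j ∈ Finset.range (N k), ‖u k j‖))
        + K * (T * r) := by ring
    _ ≤ η := by linarith

end Convergence

/-- The derivative `A X` is bounded, so each increment is `O(Δ)` and the variation is bounded
uniformly in `n`. -/
lemma IsSolution.exists_variation_le {d : ℕ} {T : ℝ} (hT : 0 ≤ T)
    {A : ℝ → Matrix (Fin d) (Fin d) ℝ} (hA : ∀ i j, ContinuousOn (fun t => A t i j) (Icc 0 T))
    {x₀ : Fin d → ℝ} {X : ℝ → Fin d → ℝ} (hX : IsSolution T A x₀ X) :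
    ∃ K : ℝ, 0 ≤ K ∧ ∀ n, ‖X (meshTime T n n)‖ + ∑ i ∈ Finset.range n,
      ‖X (meshTime T n (i + 1)) - X (meshTime T n i)‖ ≤ K := by
  obtain ⟨S, hS⟩ := isCompact_Icc.exists_bound_of_continuousOn hX.continuousOn
  obtain ⟨S', hS'⟩ := isCompact_Icc.exists_bound_of_continuousOn
    (continuousOn_mulVec hA hX.continuousOn)
  have h0 : (0 : ℝ) ∈ Icc 0 T := ⟨le_rfl, hT⟩
  have hS0 : 0 ≤ S := (norm_nonneg _).trans (hS 0 h0)
  have hS'0 : 0 ≤ S' := (norm_nonneg _).trans (hS' 0 h0)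
  refine ⟨S + T * S', by positivity, fun n => ?_⟩
  refine add_le_add (hS _ (meshTime_mem_Icc hT le_rfl)) ?_
  calc _ ≤ ∑ _i ∈ Finset.range n, S' * (T / n) := by
        refine Finset.sum_le_sum fun i hi => ?_
        have hi' := Finset.mem_range.1 hi
        have := (convex_Icc (0 : ℝ) T).norm_image_sub_le_of_norm_hasDerivWithin_le hX.2 hS'
          (meshTime_mem_Icc hT hi'.le) (meshTime_mem_Icc hT (show i + 1 ≤ n from hi'))
        rwa [meshTime_succ T n i, add_sub_cancel_left, Real.norm_of_nonneg (by positivity),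
          ← meshTime_succ T n i] at this
    _ = T / n * n * S' := by
        simp only [Finset.sum_const, Finset.card_range, nsmul_eq_mul]; ring
    _ ≤ _ := by
        gcongr
        exact div_natCast_mul_le hT n

/-! ### Decomposition of the cost and control of the noise term -/

section Cost

variable {d d' du : ℕ} {T : ℝ} {n : ℕ} {A : ℝ → Matrix (Fin d) (Fin d) ℝ}
  {B : Matrix (Fin d) (Fin du) ℝ} {C : Matrix (Fin d') (Fin d) ℝ}
  {U : Matrix (Fin du) (Fin du) ℝ}

lemma discreteCost_nonneg (hT : 0 ≤ T) (hU : U.PosDef) (y : ℕ → EuclideanSpace ℝ (Fin d'))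
    (x₀ : Fin d → ℝ) (u : ℕ → Fin du → ℝ) : 0 ≤ discreteCost T n A B C U y x₀ u := by
  refine add_nonneg (Finset.sum_nonneg fun i _ => by positivity)
    (Finset.sum_nonneg fun i _ => mul_nonneg (by positivity) ?_)
  simpa using hU.posSemidef.dotProduct_mulVec_nonneg (u i)

lemma profiledCost_le_discreteCost (hT : 0 ≤ T) (hU : U.PosDef)
    (y : ℕ → EuclideanSpace ℝ (Fin d')) (x₀ : Fin d → ℝ) (u : ℕ → Fin du → ℝ) :
    profiledCost T n A B C U y ≤ discreteCost T n A B C U y x₀ u := by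
  refine (ciInf_le ⟨0, ?_⟩ x₀).trans (ciInf_le ⟨0, ?_⟩ u)
  · rintro _ ⟨x, rfl⟩
    exact Real.iInf_nonneg fun u => discreteCost_nonneg hT hU y x u
  · rintro _ ⟨u, rfl⟩
    exact discreteCost_nonneg hT hU y x₀ u

lemma exists_discreteCost_lt_profiledCost_add (y : ℕ → EuclideanSpace ℝ (Fin d')) {η : ℝ}
    (hη : 0 < η) :
    ∃ x₀ u, discreteCost T n A B C U y x₀ u < profiledCost T n A B C U y + η := by
  obtain ⟨x₀, hx₀⟩ := exists_lt_of_ciInf_lt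
    (lt_add_of_pos_right (profiledCost T n A B C U y) hη)
  obtain ⟨u, hu⟩ := exists_lt_of_ciInf_lt hx₀
  exact ⟨x₀, u, hu⟩

/-- The observation operator with values in Euclidean space. -/
noncomputable def obsMap (C : Matrix (Fin d') (Fin d) ℝ) :
    (Fin d → ℝ) →L[ℝ] EuclideanSpace ℝ (Fin d') :=
  LinearMap.toContinuousLinearMap
    ((WithLp.linearEquiv 2 ℝ (Fin d' → ℝ)).symm.toLinearMap ∘ₗ C.mulVecLin)

lemma obsMap_apply (C : Matrix (Fin d') (Fin d) ℝ) (x : Fin d → ℝ) :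
    obsMap C x = WithLp.toLp 2 (C *ᵥ x) := rfl

/-- The observed deviation of a discrete trajectory from the true one. -/
noncomputable def residual (T : ℝ) (n : ℕ) (A : ℝ → Matrix (Fin d) (Fin d) ℝ)
    (B : Matrix (Fin d) (Fin du) ℝ) (C : Matrix (Fin d') (Fin d) ℝ) (Xstar : ℝ → Fin d → ℝ)
    (x₀ : Fin d → ℝ) (u : ℕ → Fin du → ℝ) (i : ℕ) : EuclideanSpace ℝ (Fin d') :=
  obsMap C (discreteTrajectory T n A B x₀ u i) - obsMap C (Xstar (meshTime T n i))

/-- The last term depends neither on the coefficients nor on `x₀` and `u`, so it cancels when two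
costs are compared. -/
lemma discreteCost_eq_residual (Xstar : ℝ → Fin d → ℝ) (w : ℕ → EuclideanSpace ℝ (Fin d'))
    (x₀ : Fin d → ℝ) (u : ℕ → Fin du → ℝ) :
    discreteCost T n A B C U (fun i => WithLp.toLp 2 (C *ᵥ Xstar (meshTime T n i)) + w i) x₀ u =
      T / n * (∑ i ∈ Finset.range (n + 1), ‖residual T n A B C Xstar x₀ u i‖ ^ 2)
      + T / n * (∑ i ∈ Finset.range n, u i ⬝ᵥ (U *ᵥ u i))
      - 2 * (T / n * ∑ i ∈ Finset.range (n + 1),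
          inner ℝ (residual T n A B C Xstar x₀ u i) (w i))
      + T / n * ∑ i ∈ Finset.range (n + 1), ‖w i‖ ^ 2 := by
  have e : ∀ i, ‖WithLp.toLp 2 (C *ᵥ discreteTrajectory T n A B x₀ u i)
      - (WithLp.toLp 2 (C *ᵥ Xstar (meshTime T n i)) + w i)‖ ^ 2 =
      ‖residual T n A B C Xstar x₀ u i‖ ^ 2
      - 2 * inner ℝ (residual T n A B C Xstar x₀ u i) (w i) + ‖w i‖ ^ 2 := by
    intro i
    rw [← norm_sub_sq_real, residual, obsMap_apply, obsMap_apply, sub_sub]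
  simp only [discreteCost, e, ← Finset.mul_sum, Finset.sum_add_distrib, Finset.sum_sub_distrib]
  ring

/-- Cauchy–Schwarz and coercivity of `U`: the penalty controls the discrete L¹ norm of the control,
the quantity in the stability estimates. -/
lemma sq_weighted_sum_norm_le (hT : 0 ≤ T) {κ : ℝ} (hκ : 0 < κ)
    (hU : ∀ v : Fin du → ℝ, κ * ‖v‖ ^ 2 ≤ v ⬝ᵥ (U *ᵥ v)) (u : ℕ → Fin du → ℝ) :
    (T / n * ∑ i ∈ Finset.range n, ‖u i‖) ^ 2 ≤
      T / κ * (T / n * ∑ i ∈ Finset.range n, u i ⬝ᵥ (U *ᵥ u i)) := by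
  have h1 := sq_sum_le_card_mul_sum_sq (s := Finset.range n) (f := fun i => ‖u i‖)
  rw [Finset.card_range] at h1
  have h2 : ∑ i ∈ Finset.range n, ‖u i‖ ^ 2 ≤
      κ⁻¹ * ∑ i ∈ Finset.range n, u i ⬝ᵥ (U *ᵥ u i) := by
    rw [Finset.mul_sum]
    refine Finset.sum_le_sum fun i _ => ?_
    rw [← div_eq_inv_mul, le_div_iff₀' hκ]
    exact hU _
  have hQ : 0 ≤ ∑ i ∈ Finset.range n, ‖u i‖ ^ 2 := by positivity
  calc _ = (T / n) * (T / n * (∑ i ∈ Finset.range n, ‖u i‖) ^ 2) := by ring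
    _ ≤ (T / n) * (T / n * (n * ∑ i ∈ Finset.range n, ‖u i‖ ^ 2)) := by gcongr
    _ = T / n * ((T / n * n) * ∑ i ∈ Finset.range n, ‖u i‖ ^ 2) := by ring
    _ ≤ T / n * (T * (κ⁻¹ * ∑ i ∈ Finset.range n, u i ⬝ᵥ (U *ᵥ u i))) := by
        gcongr
        exact div_natCast_mul_le hT n
    _ = _ := by field_simp

/-- The noise contribution to the cost is controlled by the normalised partial sums of the noise. -/
lemma abs_noise_le (hT : 0 ≤ T) {M b K D : ℝ} (hM : 0 ≤ M)
    (hA : ∀ t ∈ Icc (0 : ℝ) T, ∀ x, ‖A t *ᵥ x‖ ≤ M * ‖x‖) (hb : 0 ≤ b)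
    (hB : ∀ v, ‖B *ᵥ v‖ ≤ b * ‖v‖) {Xstar : ℝ → Fin d → ℝ}
    (hK : ‖Xstar (meshTime T n n)‖ + ∑ i ∈ Finset.range n,
      ‖Xstar (meshTime T n (i + 1)) - Xstar (meshTime T n i)‖ ≤ K)
    {w : ℕ → EuclideanSpace ℝ (Fin d')}
    (hw : ∀ k ≤ n + 1, T / n * ‖∑ j ∈ Finset.range k, w j‖ ≤ D)
    (x₀ : Fin d → ℝ) (u : ℕ → Fin du → ℝ) :
    |T / n * ∑ i ∈ Finset.range (n + 1), inner ℝ (residual T n A B C Xstar x₀ u i) (w i)| ≤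
      D * (‖obsMap C‖ * (((1 + T * M) * Real.exp (M * T) + 1) *
        (‖x₀‖ + b * (T / n * ∑ j ∈ Finset.range n, ‖u j‖)) + K)) := by
  have hD : 0 ≤ D := le_trans (by positivity) (hw 0 (Nat.zero_le _))
  refine (abs_mul_sum_inner_le (by positivity) _ hw).trans ?_
  refine mul_le_mul_of_nonneg_left ?_ hD
  refine le_trans ?_ (mul_le_mul_of_nonneg_left (add_le_add
    (norm_add_variation_discreteTrajectory_le (n := n) hT hM hA hb hB x₀ u) hK) (norm_nonneg _))
  set L := obsMap C
  set Z := discreteTrajectory T n A B x₀ u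
  have h1 : ∀ x y, ‖L x - L y‖ ≤ ‖L‖ * (‖x‖ + ‖y‖) := fun x y => by
    rw [← map_sub]
    exact (L.le_opNorm _).trans (by gcongr; exact norm_sub_le _ _)
  have h2 : ∀ i, ‖residual T n A B C Xstar x₀ u (i + 1) - residual T n A B C Xstar x₀ u i‖ ≤
      ‖L‖ * (‖Z (i + 1) - Z i‖ +
        ‖Xstar (meshTime T n (i + 1)) - Xstar (meshTime T n i)‖) := fun i => by
    refine le_trans (le_of_eq ?_) (h1 _ _)
    simp only [residual, map_sub]
    congr 1
    abel
  calc _ ≤ ‖L‖ * (‖Z n‖ + ‖Xstar (meshTime T n n)‖) + ∑ i ∈ Finset.range n, ‖L‖ *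
        (‖Z (i + 1) - Z i‖ + ‖Xstar (meshTime T n (i + 1)) - Xstar (meshTime T n i)‖) :=
        add_le_add (h1 _ _) (Finset.sum_le_sum fun i _ => h2 i)
    _ = _ := by
        rw [← Finset.mul_sum, Finset.sum_add_distrib]
        ring

end Cost

/-! ### Limits of rescaled near-minimisers -/

/-- Once `α < 1`, the estimate `α s ≤ (α² + s²) / 2` absorbs the linear term and leaves `s² ≤ 3 α`.
-/
lemma tendsto_zero_of_sq_le_mul_one_add {s α : ℕ → ℝ} (hs : ∀ k, 0 ≤ s k)
    (hα : Tendsto α atTop (𝓝 0)) (hα0 : ∀ k, 0 ≤ α k)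
    (h : ∀ᶠ k in atTop, s k ^ 2 ≤ α k * (1 + s k)) : Tendsto s atTop (𝓝 0) := by
  have hlim : Tendsto (fun k => √(3 * α k)) atTop (𝓝 0) := by
    have := (hα.const_mul 3).sqrt
    simpa using this
  refine squeeze_zero' (Eventually.of_forall hs) ?_ hlim
  filter_upwards [h, hα.eventually (gt_mem_nhds one_pos)] with k hk h1
  refine Real.le_sqrt_of_sq_le ?_
  nlinarith [sq_nonneg (s k - 1), sq_nonneg (s k), hα0 k, mul_nonneg (hα0 k) (sq_nonneg (s k - 1)),
    mul_nonneg (sub_nonneg.2 h1.le) (sq_nonneg (s k))]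

lemma div_natCast_mul_add_one_le {T : ℝ} (hT : 0 ≤ T) (n : ℕ) : T / n * (n + 1) ≤ 2 * T := by
  rcases Nat.eq_zero_or_pos n with rfl | hn
  · simpa using hT
  · have h1 : (1 : ℝ) ≤ n := by exact_mod_cast hn
    have := div_le_self hT h1
    linarith [div_natCast_mul_le hT n]

section Deterministic

variable {d d' du : ℕ} {T : ℝ} {B : Matrix (Fin d) (Fin du) ℝ} {C : Matrix (Fin d') (Fin d) ℝ}
  {U : Matrix (Fin du) (Fin du) ℝ}

/-- At the true parameter and initial condition the cost exceeds the pure noise level by a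
negligible amount. -/
lemma exists_tendsto_zero_reference_cost_le (hT : 0 < T) {A : ℝ → Matrix (Fin d) (Fin d) ℝ}
    (hA : ∀ i j, ContinuousOn (fun t => A t i j) (Icc 0 T)) {x₀ : Fin d → ℝ}
    {X : ℝ → Fin d → ℝ} (hX : IsSolution T A x₀ X) {w : ℕ → EuclideanSpace ℝ (Fin d')}
    {D : ℕ → ℝ} (hD : Tendsto D atTop (𝓝 0))
    (hw : ∀ n, ∀ k ≤ n + 1, T / n * ‖∑ j ∈ Finset.range k, w j‖ ≤ D n) :
    ∃ τ : ℕ → ℝ, Tendsto τ atTop (𝓝 0) ∧ ∀ n : ℕ,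
      T / n * (∑ i ∈ Finset.range (n + 1),
        ‖residual T n A B C X x₀ (fun _ => (0 : Fin du → ℝ)) i‖ ^ 2)
      - 2 * (T / n * ∑ i ∈ Finset.range (n + 1),
          inner ℝ (residual T n A B C X x₀ (fun _ => (0 : Fin du → ℝ)) i) (w i)) ≤ τ n := by
  obtain ⟨M, hM0, hM⟩ := exists_norm_mulVec_le hA
  set b := ‖LinearMap.toContinuousLinearMap B.mulVecLin‖
  have hB : ∀ v, ‖B *ᵥ v‖ ≤ b * ‖v‖ := fun v =>
    (LinearMap.toContinuousLinearMap B.mulVecLin).le_opNorm v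
  obtain ⟨K, hK0, hK⟩ := hX.exists_variation_le hT.le hA
  obtain ⟨ρ, hρ, hρX⟩ := exists_tendsto_zero_norm_discreteTrajectory_sub_le (B := B) hT hA
    (A := fun _ => A) (fun η hη => Eventually.of_forall fun _ t _ x => by
      simpa using mul_nonneg hη.le (norm_nonneg x)) tendsto_id hX
    (x := fun _ => x₀) tendsto_const_nhds (u := fun _ _ => 0) (by simp)
  set L := obsMap C
  set K' := ‖L‖ * (((1 + T * M) * Real.exp (M * T) + 1) * ‖x₀‖ + K)
  refine ⟨fun n => 2 * T * (‖L‖ * ρ n) ^ 2 + 2 * (D n * K'), ?_, fun n => ?_⟩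
  · have := (((hρ.const_mul ‖L‖).pow 2).const_mul (2 * T)).add ((hD.mul_const K').const_mul 2)
    simpa using this
  · have h1 := abs_noise_le (C := C) hT.le hM0 hM (norm_nonneg _) hB (hK n) (hw n) x₀ (fun _ => 0)
    simp only [norm_zero, Finset.sum_const_zero, mul_zero, add_zero] at h1
    have h2 : T / n * (∑ i ∈ Finset.range (n + 1),
        ‖residual T n A B C X x₀ (fun _ => (0 : Fin du → ℝ)) i‖ ^ 2) ≤
        2 * T * (‖L‖ * ρ n) ^ 2 := by
      calc _ ≤ T / n * (∑ _i ∈ Finset.range (n + 1), (‖L‖ * ρ n) ^ 2) := by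
            gcongr with i hi
            rw [residual, ← map_sub]
            refine (L.le_opNorm _).trans ?_
            gcongr
            exact hρX n i (by have := Finset.mem_range.1 hi; simp only [id]; omega)
        _ = T / n * (n + 1) * (‖L‖ * ρ n) ^ 2 := by
            simp only [Finset.sum_const, Finset.card_range, nsmul_eq_mul]
            push_cast
            ring
        _ ≤ _ := by
            exact mul_le_mul_of_nonneg_right (div_natCast_mul_add_one_le hT.le n) (sq_nonneg _)
    have h3 := (neg_le_abs _).trans h1
    linarith

/-- Limits of rescaled near-minimisers: the rescaled controls vanish and the rescaled trajectories
converge to an unforced solution whose output is proportional to the true one. -/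
lemma exists_isSolution_of_near_minimizers (hT : 0 < T) (hU : U.PosDef)
    {Xstar : ℝ → Fin d → ℝ} (hXc : ContinuousOn Xstar (Icc 0 T)) {K : ℝ} (hK0 : 0 ≤ K)
    (hK : ∀ n, ‖Xstar (meshTime T n n)‖ + ∑ i ∈ Finset.range n,
      ‖Xstar (meshTime T n (i + 1)) - Xstar (meshTime T n i)‖ ≤ K)
    {A : ℕ → ℝ → Matrix (Fin d) (Fin d) ℝ} {A₀ : ℝ → Matrix (Fin d) (Fin d) ℝ}
    (hA₀ : ∀ i j, ContinuousOn (fun t => A₀ t i j) (Icc 0 T))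
    (hA : ∀ η > 0, ∀ᶠ k in atTop, ∀ t ∈ Icc (0 : ℝ) T, ∀ x, ‖(A k t - A₀ t) *ᵥ x‖ ≤ η * ‖x‖)
    {N : ℕ → ℕ} (hN : Tendsto N atTop atTop)
    {w : ℕ → EuclideanSpace ℝ (Fin d')} {D τ : ℕ → ℝ} (hD : Tendsto D atTop (𝓝 0))
    (hw : ∀ n, ∀ k ≤ n + 1, T / n * ‖∑ j ∈ Finset.range k, w j‖ ≤ D n)
    (hτ : Tendsto τ atTop (𝓝 0)) {x : ℕ → Fin d → ℝ} {u : ℕ → ℕ → Fin du → ℝ}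
    (hmin : ∀ᶠ k in atTop,
      T / N k * (∑ i ∈ Finset.range (N k + 1),
          ‖residual T (N k) (A k) B C Xstar (x k) (u k) i‖ ^ 2)
        + T / N k * (∑ i ∈ Finset.range (N k), u k i ⬝ᵥ (U *ᵥ u k i))
        - 2 * (T / N k * ∑ i ∈ Finset.range (N k + 1),
          inner ℝ (residual T (N k) (A k) B C Xstar (x k) (u k) i) (w i)) ≤ τ (N k))
    {c : ℝ} (hc : Tendsto (fun k => (1 + ‖x k‖)⁻¹) atTop (𝓝 c)) {x₀ : Fin d → ℝ}
    (hx₀ : Tendsto (fun k => (1 + ‖x k‖)⁻¹ • x k) atTop (𝓝 x₀)) :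
    ∃ X, IsSolution T A₀ x₀ X ∧ ∀ t ∈ Icc (0 : ℝ) T, C *ᵥ X t = c • (C *ᵥ Xstar t) := by
  obtain ⟨X, hX⟩ := exists_isSolution hT.le hA₀ x₀
  refine ⟨X, hX, ?_⟩
  obtain ⟨M, hM0, hM⟩ := exists_norm_mulVec_le hA₀
  obtain ⟨κ, hκ, hκU⟩ := exists_mul_norm_sq_le_dotProduct hU
  set b := ‖LinearMap.toContinuousLinearMap B.mulVecLin‖
  have hb : 0 ≤ b := norm_nonneg _
  have hB : ∀ v, ‖B *ᵥ v‖ ≤ b * ‖v‖ := fun v =>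
    (LinearMap.toContinuousLinearMap B.mulVecLin).le_opNorm v
  set L := obsMap C
  set l : ℕ → ℝ := fun k => (1 + ‖x k‖)⁻¹
  have hl0 : ∀ k, 0 < l k := fun k => by positivity
  have hl1 : ∀ k, l k ≤ 1 := fun k => inv_le_one_of_one_le₀ (by linarith [norm_nonneg (x k)])
  have hlx : ∀ k, l k * (1 + ‖x k‖) = 1 := fun k => inv_mul_cancel₀ (by positivity)
  set v : ℕ → ℝ := fun k => T / N k * ∑ j ∈ Finset.range (N k), ‖u k j‖
  have hv0 : ∀ k, 0 ≤ v k := fun k => by positivity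
  set E : ℕ → ℝ := fun k => T / N k * (∑ i ∈ Finset.range (N k + 1),
    ‖residual T (N k) (A k) B C Xstar (x k) (u k) i‖ ^ 2) with hE
  set Q : ℕ → ℝ := fun k => T / N k * (∑ i ∈ Finset.range (N k), u k i ⬝ᵥ (U *ᵥ u k i))
  have hE0 : ∀ k, 0 ≤ E k := fun k => by positivity
  have hvQ : ∀ k, v k ^ 2 ≤ T / κ * Q k := fun k => sq_weighted_sum_norm_le hT.le hκ hκU (u k)
  have hQ0 : ∀ k, 0 ≤ Q k := fun k => by
    have h := (sq_nonneg (v k)).trans (hvQ k)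
    exact nonneg_of_mul_nonneg_right h (by positivity)
  set G := ((1 + T * (M + 1)) * Real.exp ((M + 1) * T) + 1)
  have hG : 0 ≤ G := by positivity
  set P := 2 * (‖L‖ * (G * (1 + b) + K))
  have hP : 0 ≤ P := by positivity
  have hD0 : ∀ n, 0 ≤ D n := fun n => le_trans (by positivity) (hw n 0 (Nat.zero_le _))
  set α : ℕ → ℝ := fun k => P * D (N k) + |τ (N k)|
  have hα : Tendsto α atTop (𝓝 0) := by
    have := ((hD.comp hN).const_mul P).add (hτ.comp hN).abs
    simpa using this
  have hα0 : ∀ k, 0 ≤ α k := fun k => add_nonneg (mul_nonneg hP (hD0 _)) (abs_nonneg _)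
  -- The energy is quadratic while the noise bound is linear in `1 + ‖x‖ + v`. Of the factor `l²`,
  -- one `l` normalises `1 + ‖x‖` to `1` and the other is merely bounded by `1`.
  have hEQ : ∀ᶠ k in atTop, l k ^ 2 * E k + l k ^ 2 * Q k ≤ α k * (1 + l k * v k) := by
    filter_upwards [hmin, eventually_norm_mulVec_le_of_close hA hM] with k hk hMk
    have h1 := (le_abs_self _).trans (abs_noise_le (C := C) hT.le (by positivity) hMk hb hB
      (hK (N k)) (hw (N k)) (x k) (u k))
    change _ ≤ D (N k) * (‖L‖ * (G * (‖x k‖ + b * v k) + K)) at h1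
    have h2 : E k + Q k ≤ τ (N k) + 2 * (D (N k) * (‖L‖ * (G * (‖x k‖ + b * v k) + K))) := by
      linarith
    have hx0 := norm_nonneg (x k)
    have h3 : 2 * (‖L‖ * (G * (‖x k‖ + b * v k) + K)) ≤ P * (1 + ‖x k‖ + v k) := by
      have : G * (‖x k‖ + b * v k) + K ≤ (G * (1 + b) + K) * (1 + ‖x k‖ + v k) := by
        have e : (G * (1 + b) + K) * (1 + ‖x k‖ + v k) - (G * (‖x k‖ + b * v k) + K) =
          G * (1 + v k) + G * b * (1 + ‖x k‖) + K * (‖x k‖ + v k) := by ring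
        have : 0 ≤ G * (1 + v k) + G * b * (1 + ‖x k‖) + K * (‖x k‖ + v k) := by
          have := hv0 k
          positivity
        linarith
      calc _ ≤ 2 * (‖L‖ * ((G * (1 + b) + K) * (1 + ‖x k‖ + v k))) := by gcongr
        _ = _ := by simp only [P]; ring
    have h4 : E k + Q k ≤ |τ (N k)| + D (N k) * (P * (1 + ‖x k‖ + v k)) := by
      have := mul_le_mul_of_nonneg_left h3 (hD0 (N k))
      linarith [le_abs_self (τ (N k))]
    have hl := hl0 k
    have hl' := hl1 k
    have hlv : 0 ≤ l k * v k := mul_nonneg hl.le (hv0 k)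
    calc l k ^ 2 * E k + l k ^ 2 * Q k = l k ^ 2 * (E k + Q k) := by ring
      _ ≤ l k ^ 2 * (|τ (N k)| + D (N k) * (P * (1 + ‖x k‖ + v k))) := by gcongr
      _ = l k ^ 2 * |τ (N k)| + l k * (P * D (N k) * (l k * (1 + ‖x k‖) + l k * v k)) := by ring
      _ ≤ 1 * |τ (N k)| + 1 * (P * D (N k) * (l k * (1 + ‖x k‖) + l k * v k)) := by
          have := hD0 (N k)
          have h5 : 0 ≤ P * D (N k) * (l k * (1 + ‖x k‖) + l k * v k) := by positivity
          gcongr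
          exact pow_le_one₀ hl.le hl'
      _ ≤ _ := by
          rw [hlx]
          have := mul_nonneg (abs_nonneg (τ (N k))) hlv
          simp only [α]
          linarith
  -- Since `v²` is controlled by `Q`, the inequality closes on `l v` itself.
  have hs : Tendsto (fun k => l k * v k) atTop (𝓝 0) := by
    refine tendsto_zero_of_sq_le_mul_one_add (fun k => mul_nonneg (hl0 k).le (hv0 k))
      (α := fun k => T / κ * α k) (by simpa using hα.const_mul (T / κ))
      (fun k => mul_nonneg (by positivity) (hα0 k)) ?_
    filter_upwards [hEQ] with k hk
    have h0 : 0 ≤ l k ^ 2 * E k := mul_nonneg (sq_nonneg _) (hE0 k)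
    calc (l k * v k) ^ 2 = l k ^ 2 * v k ^ 2 := by ring
      _ ≤ l k ^ 2 * (T / κ * Q k) := by gcongr; exact hvQ k
      _ = T / κ * (l k ^ 2 * Q k) := by ring
      _ ≤ T / κ * (α k * (1 + l k * v k)) :=
          mul_le_mul_of_nonneg_left (by linarith) (by positivity)
      _ = _ := by ring
  have hElim : Tendsto (fun k => l k ^ 2 * E k) atTop (𝓝 0) := by
    have h1 : Tendsto (fun k => α k * (1 + l k * v k)) atTop (𝓝 0) := by
      simpa using hα.mul (hs.const_add 1)
    refine squeeze_zero' (Eventually.of_forall fun k => mul_nonneg (sq_nonneg _) (hE0 k)) ?_ h1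
    filter_upwards [hEQ] with k hk
    linarith [mul_nonneg (sq_nonneg (l k)) (hQ0 k)]
  obtain ⟨ρ, hρ, hρX⟩ := exists_tendsto_zero_norm_discreteTrajectory_sub_le (B := B) hT hA₀ hA hN hX
    hx₀ (u := fun k => l k • u k) (by
      refine hs.congr fun k => ?_
      simp only [v, Pi.smul_apply, norm_smul, ← Finset.mul_sum, Real.norm_of_nonneg (hl0 k).le]
      ring)
  obtain ⟨S, hS⟩ := isCompact_Icc.exists_bound_of_continuousOn hXc
  have hS0 : 0 ≤ S := (norm_nonneg _).trans (hS 0 ⟨le_rfl, hT.le⟩)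
  set g : ℝ → EuclideanSpace ℝ (Fin d') := fun t => L (X t) - c • L (Xstar t)
  have hgc : ContinuousOn g (Icc 0 T) :=
    (L.continuous.comp_continuousOn hX.continuousOn).sub
      ((L.continuous.comp_continuousOn hXc).const_smul c)
  have hpoint : ∀ k, ∀ i ≤ N k, ‖g (meshTime T (N k) i)‖ ^ 2 ≤
      2 * (l k ^ 2 * ‖residual T (N k) (A k) B C Xstar (x k) (u k) i‖ ^ 2)
        + 2 * (‖L‖ * ρ k + |l k - c| * (‖L‖ * S)) ^ 2 := by
    intro k i hi
    set t := meshTime T (N k) i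
    set z := residual T (N k) (A k) B C Xstar (x k) (u k) i with hz
    have hX' := hρX k i hi
    rw [discreteTrajectory_smul] at hX'
    set y := discreteTrajectory T (N k) (A k) B (x k) (u k) i with hy
    -- Three errors: the rescaled residual, small in mean square; the discretisation error of the
    -- rescaled trajectory; and the error in `l → c`.
    have e : g t = l k • z - L (l k • y - X t) + (l k - c) • L (Xstar t) := by
      simp only [g, hz, residual, map_sub, map_smul, smul_sub, sub_smul]
      abel
    have h1 : ‖g t‖ ≤ l k * ‖z‖ + (‖L‖ * ρ k + |l k - c| * (‖L‖ * S)) := by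
      rw [e]
      calc _ ≤ ‖l k • z‖ + ‖L (l k • y - X t)‖ + ‖(l k - c) • L (Xstar t)‖ :=
            (norm_add_le _ _).trans (by gcongr; exact norm_sub_le _ _)
        _ ≤ l k * ‖z‖ + ‖L‖ * ρ k + |l k - c| * (‖L‖ * S) := by
            rw [norm_smul, norm_smul, Real.norm_of_nonneg (hl0 k).le, Real.norm_eq_abs]
            gcongr
            · exact (L.le_opNorm _).trans (by gcongr)
            · exact (L.le_opNorm _).trans (by gcongr; exact hS t (meshTime_mem_Icc hT.le hi))
        _ = _ := by ring
    calc ‖g t‖ ^ 2 ≤ (l k * ‖z‖ + (‖L‖ * ρ k + |l k - c| * (‖L‖ * S))) ^ 2 := by gcongr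
      _ ≤ _ := by
          refine add_sq_le.trans (le_of_eq ?_)
          ring
  have hR : Tendsto (fun k => T / N k * ∑ i ∈ Finset.range (N k),
      ‖g (meshTime T (N k) i)‖ ^ 2) atTop (𝓝 0) := by
    have hlc : Tendsto (fun k => |l k - c|) atTop (𝓝 0) := by
      have := (hc.sub_const c).abs
      simpa using this
    have hup : Tendsto (fun k => 2 * (l k ^ 2 * E k)
        + T * (2 * (‖L‖ * ρ k + |l k - c| * (‖L‖ * S)) ^ 2)) atTop (𝓝 0) := by
      have := (hElim.const_mul 2).add (((((hρ.const_mul ‖L‖).add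
        (hlc.mul_const (‖L‖ * S))).pow 2).const_mul 2).const_mul T)
      simpa using this
    refine squeeze_zero (fun k => by positivity) (fun k => ?_) hup
    have hTn : 0 ≤ T / N k := by positivity
    set q := 2 * (‖L‖ * ρ k + |l k - c| * (‖L‖ * S)) ^ 2
    have hq : 0 ≤ q := by positivity
    calc _ ≤ T / N k * ∑ i ∈ Finset.range (N k),
          (2 * (l k ^ 2 * ‖residual T (N k) (A k) B C Xstar (x k) (u k) i‖ ^ 2) + q) := by
          gcongr with i hi
          exact hpoint k i (Finset.mem_range.1 hi).le
      _ = 2 * (l k ^ 2 * (T / N k * ∑ i ∈ Finset.range (N k),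
            ‖residual T (N k) (A k) B C Xstar (x k) (u k) i‖ ^ 2)) + T / N k * N k * q := by
          rw [Finset.sum_add_distrib, ← Finset.mul_sum, ← Finset.mul_sum]
          simp only [Finset.sum_const, Finset.card_range, nsmul_eq_mul]
          ring
      _ ≤ _ := by
          refine add_le_add ?_ (mul_le_mul_of_nonneg_right (div_natCast_mul_le hT.le _) hq)
          simp only [hE]
          gcongr
          omega
  have hzero := eq_zero_of_tendsto_riemannSum hT (hgc.norm.pow 2) (fun t _ => sq_nonneg _) hN hR
  intro t ht
  have hgt : g t = 0 := norm_eq_zero.1 (pow_eq_zero_iff two_ne_zero |>.1 (hzero t ht))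
  exact WithLp.toLp_injective 2 (sub_eq_zero.1 hgt)

end Deterministic

/-! ### Consistency -/

/-- Consistency for every noise sequence whose averages vanish. -/
theorem tendsto_of_minimizes_profiledCost {d d' du p : ℕ} {T : ℝ} (hT : 0 < T)
    {Θ : Set (EuclideanSpace ℝ (Fin p))} (hΘ : IsCompact Θ)
    {A : EuclideanSpace ℝ (Fin p) → ℝ → Matrix (Fin d) (Fin d) ℝ}
    {B : Matrix (Fin d) (Fin du) ℝ} {C : Matrix (Fin d') (Fin d) ℝ}
    {U : Matrix (Fin du) (Fin du) ℝ} (hU : U.PosDef)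
    {θstar : EuclideanSpace ℝ (Fin p)} {x₀star : Fin d → ℝ} {Xstar : ℝ → Fin d → ℝ}
    (hXstar : IsSolution T (A θstar) x₀star Xstar)
    (hcont : ∀ θ ∈ Θ, ∀ i j, ContinuousOn (fun t => A θ t i j) (Icc 0 T))
    (hunif : ∀ θ ∈ Θ, TendstoUniformlyOn A (A θ) (𝓝[Θ] θ) (Icc 0 T))
    (hobs : ∀ θ ∈ Θ, ∀ (x₀ : Fin d → ℝ) (X : ℝ → Fin d → ℝ), IsSolution T (A θ) x₀ X →
      (∀ t ∈ Icc 0 T, C *ᵥ X t = 0) → x₀ = 0)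
    (hθstar : θstar ∈ Θ)
    (hident : ∀ θ ∈ Θ, ∀ (x₀ : Fin d → ℝ) (X : ℝ → Fin d → ℝ), IsSolution T (A θ) x₀ X →
      (∀ t ∈ Icc 0 T, C *ᵥ X t = C *ᵥ Xstar t) → θ = θstar ∧ x₀ = x₀star)
    {w : ℕ → EuclideanSpace ℝ (Fin d')}
    (hw : Tendsto (fun n : ℕ => (n : ℝ)⁻¹ • ∑ j ∈ Finset.range n, w j) atTop (𝓝 0))
    {θ : ℕ → EuclideanSpace ℝ (Fin p)}
    (hmin : ∀ᶠ n : ℕ in atTop, θ n ∈ Θ ∧ ∀ θ' ∈ Θ,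
      profiledCost T n (A (θ n)) B C U
          (fun i => WithLp.toLp 2 (C *ᵥ Xstar (meshTime T n i)) + w i) ≤
        profiledCost T n (A θ') B C U
          (fun i => WithLp.toLp 2 (C *ᵥ Xstar (meshTime T n i)) + w i)) :
    Tendsto θ atTop (𝓝 θstar) := by
  obtain ⟨D, hD, hDw⟩ := exists_tendsto_zero_forall_norm_partialSum_le hT.le hw
  obtain ⟨τ, hτ, hτle⟩ := exists_tendsto_zero_reference_cost_le (B := B) (C := C) hT
    (hcont θstar hθstar) hXstar hD hDw
  obtain ⟨K, hK0, hK⟩ := hXstar.exists_variation_le hT.le (hcont θstar hθstar)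
  -- A vanishing slack, so that attainment of the inner infima is not needed.
  have hη : ∀ n : ℕ, (0 : ℝ) < 1 / ((n : ℝ) + 1) := fun n => by positivity
  choose x u hxu using fun n : ℕ => exists_discreteCost_lt_profiledCost_add (T := T) (n := n)
    (A := A (θ n)) (B := B) (C := C) (U := U)
    (fun i => WithLp.toLp 2 (C *ᵥ Xstar (meshTime T n i)) + w i) (hη n)
  have hτ' : Tendsto (fun n : ℕ => τ n + 1 / ((n : ℝ) + 1)) atTop (𝓝 0) := by
    simpa using hτ.add tendsto_one_div_add_atTop_nhds_zero_nat
  have hnear : ∀ᶠ n : ℕ in atTop,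
      T / n * (∑ i ∈ Finset.range (n + 1), ‖residual T n (A (θ n)) B C Xstar (x n) (u n) i‖ ^ 2)
        + T / n * (∑ i ∈ Finset.range n, u n i ⬝ᵥ (U *ᵥ u n i))
        - 2 * (T / n * ∑ i ∈ Finset.range (n + 1),
          inner ℝ (residual T n (A (θ n)) B C Xstar (x n) (u n) i) (w i)) ≤
        τ n + 1 / ((n : ℝ) + 1) := by
    filter_upwards [hmin] with n hn
    have h1 := (hxu n).le.trans (add_le_add ((hn.2 θstar hθstar).trans
      (profiledCost_le_discreteCost hT.le hU _ x₀star (fun _ => 0))) le_rfl)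
    rw [discreteCost_eq_residual, discreteCost_eq_residual] at h1
    have h2 := hτle n
    simp only [zero_dotProduct, Finset.sum_const_zero, mul_zero, add_zero] at h1
    linarith
  refine tendsto_of_subseq_tendsto fun ns hns => ?_
  set l : ℕ → ℝ := fun n => (1 + ‖x n‖)⁻¹
  have hl : ∀ n, l n ∈ Icc (0 : ℝ) 1 := fun n =>
    ⟨by positivity, inv_le_one_of_one_le₀ (by linarith [norm_nonneg (x n)])⟩
  -- In the limit `‖x₀‖ = 1 - c`, so `x₀` and `c` cannot both vanish.
  have hlx : ∀ n, ‖l n • x n‖ = 1 - l n := fun n => by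
    have h0 : (1 + ‖x n‖) ≠ 0 := by positivity
    rw [norm_smul, Real.norm_of_nonneg (hl n).1]
    simp only [l]
    field_simp
    ring
  have hball : ∀ n, l n • x n ∈ Metric.closedBall (0 : Fin d → ℝ) 1 := fun n => by
    rw [mem_closedBall_zero_iff, hlx]
    linarith [(hl n).1]
  have hcomp : IsCompact (Θ ×ˢ (Icc (0 : ℝ) 1 ×ˢ Metric.closedBall (0 : Fin d → ℝ) 1)) :=
    hΘ.prod (isCompact_Icc.prod (isCompact_closedBall _ _))
  have hmem : ∃ᶠ k in atTop, (θ (ns k), l (ns k), l (ns k) • x (ns k)) ∈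
      Θ ×ˢ (Icc (0 : ℝ) 1 ×ˢ Metric.closedBall (0 : Fin d → ℝ) 1) := by
    refine Eventually.frequently ?_
    filter_upwards [hns.eventually hmin] with k hk
    exact ⟨hk.1, hl _, hball _⟩
  obtain ⟨⟨θ₀, c, x₀⟩, ⟨hθ₀, -, -⟩, φ, hφ, hlim⟩ := hcomp.tendsto_subseq' hmem
  rw [nhds_prod_eq, nhds_prod_eq] at hlim
  have hθlim : Tendsto (fun k => θ (ns (φ k))) atTop (𝓝 θ₀) := hlim.fst
  have hclim : Tendsto (fun k => l (ns (φ k))) atTop (𝓝 c) := hlim.snd.fst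
  have hxlim : Tendsto (fun k => l (ns (φ k)) • x (ns (φ k))) atTop (𝓝 x₀) := hlim.snd.snd
  have hN : Tendsto (fun k => ns (φ k)) atTop atTop := hns.comp hφ.tendsto_atTop
  have hθwithin : Tendsto (fun k => θ (ns (φ k))) atTop (𝓝[Θ] θ₀) :=
    tendsto_nhdsWithin_iff.2 ⟨hθlim, (hN.eventually hmin).mono fun k hk => hk.1⟩
  obtain ⟨X, hX, hCX⟩ := exists_isSolution_of_near_minimizers hT hU hXstar.continuousOn hK0 hK
    (hcont θ₀ hθ₀) (A := fun k => A (θ (ns (φ k))))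
    (fun η hη => hθwithin.eventually (eventually_norm_sub_mulVec_le (hunif θ₀ hθ₀) hη)) hN hD hDw
    hτ' (hN.eventually hnear) hclim hxlim
  have hnorm : ‖x₀‖ = 1 - c :=
    tendsto_nhds_unique hxlim.norm (by simpa only [hlx] using hclim.const_sub 1)
  -- If `c = 0`, the limit has zero output, so observability forces `x₀ = 0`, against `‖x₀‖ = 1`.
  have hc : c ≠ 0 := by
    rintro rfl
    have := hobs θ₀ hθ₀ x₀ X hX (fun t ht => by rw [hCX t ht, zero_smul])
    simp [this] at hnorm
  have := (hident θ₀ hθ₀ _ _ (hX.smul c⁻¹) fun t ht => by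
    rw [Matrix.mulVec_smul, hCX t ht, smul_smul, inv_mul_cancel₀ hc, one_smul]).1
  exact ⟨φ, this ▸ hθlim⟩

/-- Averages of independent centred Gaussian errors vanish almost surely. -/
lemma ae_tendsto_average_zero {d' : ℕ} {Ω : Type*} [MeasurableSpace Ω] {μ : Measure Ω}
    {S : Matrix (Fin d') (Fin d') ℝ} {ε : ℕ → Ω → EuclideanSpace ℝ (Fin d')}
    (hlaw : ∀ i, HasLaw (ε i) (multivariateGaussian 0 S) μ) (hindep : iIndepFun ε μ) :
    ∀ᵐ ω ∂μ, Tendsto (fun n : ℕ => (n : ℝ)⁻¹ • ∑ i ∈ Finset.range n, ε i ω) atTop (𝓝 0) := by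
  have hmean : μ[ε 0] = 0 := by
    rw [(hlaw 0).integral_eq]
    exact integral_id_multivariateGaussian
  have hint : Integrable (ε 0) μ := by
    have h : Integrable id (μ.map (ε 0)) := by
      rw [(hlaw 0).map_eq]
      exact IsGaussian.integrable_id
    exact h.comp_aemeasurable (hlaw 0).aemeasurable
  have h := strong_law_ae ε hint (fun i j hij => hindep.indepFun hij)
    (fun i => ⟨(hlaw i).aemeasurable, (hlaw 0).aemeasurable, by
      rw [(hlaw i).map_eq, (hlaw 0).map_eq]⟩)
  rwa [hmean] at h

end LinearODEModel

theorem mainTheorem4 {d d' du p : ℕ} (T : ℝ) (hT : 0 < T)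
    (Θ : Set (EuclideanSpace ℝ (Fin p))) (hΘ : IsCompact Θ)
    (A : EuclideanSpace ℝ (Fin p) → ℝ → Matrix (Fin d) (Fin d) ℝ)
    (B : Matrix (Fin d) (Fin du) ℝ) (C : Matrix (Fin d') (Fin d) ℝ)
    (U : Matrix (Fin du) (Fin du) ℝ) (hU : U.PosDef)
    (θstar : EuclideanSpace ℝ (Fin p)) (x₀star : Fin d → ℝ) (Xstar : ℝ → Fin d → ℝ)
    (hXstar : LinearODEModel.IsSolution T (A θstar) x₀star Xstar)
    -- L1: each `t ↦ A_θ(t)` is differentiable on `[0, T]`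
    (hL1 : ∀ θ ∈ Θ, ∀ i j, DifferentiableOn ℝ (fun t => A θ t i j) (Icc 0 T))
    -- L2: `θ ↦ A_θ` is continuous on `Θ`, for the uniform topology on functions on `[0, T]`
    (hL2 : ∀ θ ∈ Θ, TendstoUniformlyOn A (A θ) (𝓝[Θ] θ) (Icc 0 T))
    -- L3: `R_θ(0)` is nonsingular, `R_θ` being the solution of the Riccati equation
    (hL3 : ∀ θ ∈ Θ, ∃ R : ℝ → Matrix (Fin d) (Fin d) ℝ,
      LinearODEModel.IsRiccatiSolution T (A θ) B C U R ∧ IsUnit (R 0))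
    -- L4: the true parameter is interior
    (hL4 : θstar ∈ interior Θ)
    -- L5: identifiability of `(θ*, x₀*)` from the noiseless signal
    (hL5 : ∀ θ ∈ Θ, ∀ (x₀ : Fin d → ℝ) (X : ℝ → Fin d → ℝ),
      LinearODEModel.IsSolution T (A θ) x₀ X →
      (∀ t ∈ Icc 0 T, C *ᵥ X t = C *ᵥ Xstar t) → θ = θstar ∧ x₀ = x₀star)
    -- the measurement errors are i.i.d. `N(0, σ² I)`
    {Ω : Type*} [MeasurableSpace Ω] (μ : Measure Ω) [IsProbabilityMeasure μ] (σ : ℝ)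
    (ε : ℕ → Ω → EuclideanSpace ℝ (Fin d'))
    (hε_law : ∀ i, HasLaw (ε i)
      (multivariateGaussian 0 (σ ^ 2 • (1 : Matrix (Fin d') (Fin d') ℝ))) μ)
    (hε_indep : iIndepFun ε μ)
    -- the estimators: random variables minimizing the profiled cost over `Θ` for large `n`
    (θhat : ℕ → Ω → EuclideanSpace ℝ (Fin p)) (hθhat_meas : ∀ n, AEMeasurable (θhat n) μ)
    (hθhat : ∀ᶠ n : ℕ in atTop, ∀ᵐ ω ∂μ, θhat n ω ∈ Θ ∧ ∀ θ ∈ Θ,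
      LinearODEModel.profiledCost T n (A (θhat n ω)) B C U
          (LinearODEModel.observation T n C Xstar ε ω) ≤
        LinearODEModel.profiledCost T n (A θ) B C U
          (LinearODEModel.observation T n C Xstar ε ω)) :
    TendstoInMeasure μ θhat atTop (fun _ => θstar) := by
  have hcont : ∀ θ ∈ Θ, ∀ i j, ContinuousOn (fun t => A θ t i j) (Icc 0 T) :=
    fun θ hθ i j => (hL1 θ hθ i j).continuousOn
  refine tendstoInMeasure_of_tendsto_ae (fun n => (hθhat_meas n).aestronglyMeasurable) ?_
  obtain ⟨n₀, hn₀⟩ := eventually_atTop.1 hθhat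
  -- Countability of the indices gives one null set outside which minimality holds for every `n ≥
  -- n₀`.
  have hmin := ae_all_iff.2 fun n : ℕ => ae_all_iff.2 fun hn : n₀ ≤ n => hn₀ n hn
  filter_upwards [LinearODEModel.ae_tendsto_average_zero hε_law hε_indep, hmin] with ω hω hmin
  refine LinearODEModel.tendsto_of_minimizes_profiledCost hT hΘ hU hXstar hcont hL2 ?_
    (interior_subset hL4) hL5 hω (eventually_atTop.2 ⟨n₀, hmin⟩)
  intro θ hθ x₀ X hX hCX
  obtain ⟨R, hR, hR0⟩ := hL3 θ hθ
  exact LinearODEModel.eq_zero_of_forall_mulVec_eq_zero hT.le (hcont θ hθ) hR hR0 hX hCX
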